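/- Let $p\in\mathbb N$, and let $(X_i,Y_i)_{i\ge1}$ be i.i.d. random vectors with values (almost surely) in $\mathbb R_+^p\times\mathbb R_+$. Write $X\le x$ for the componentwise order, $F(x,y)=\mathbb P(X_1\le x,\,Y_1\le y)$ and $F_X(x)=\mathbb P(X_1\le x)$. Fix $x\in\mathbb R_+^p$ with $F_X(x)>0$, and put $F(y\mid x)=F(x,y)/F_X(x)$, $$\varphi(x)=\sup\{y\ge0: F(y\mid x)<1\},\qquad \varphi_\alpha(x)=\inf\{y\ge0:F(y\mid x)\ge\alpha\},\qquad \hat\varphi_1(x)=\hat\varphi_{1,n}(x)=\max_{1\le i\le n,\;X_i\le x}Y_i ,$$ where $\sup\emptyset=0$ and $\hat\varphi_1(x)=0$ if no $i\le n$ satisfies $X_i\le x$. Assume $\varphi(x)<\infty$. For $\rho>0$ let $\Psi_\rho(y)=\exp\{-(-y)^{\rho}\}$ for $y\le0$ and $\Psi_\rho(y)=1$ for $y>0$, and consider the condition $$(\mathrm{RV}_\rho)\qquad \lim_{t\to\infty}\frac{1-F\bigl(\varphi(x)-\frac1{tz}\mid x\bigr)}{1-F\bigl(\varphi(x)-\frac1t\mid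 x\bigr)}=z^{-\rho}\quad\text{for all }z>0 .$$ (i) If $b_n>0$ and $b_n^{-1}(\hat\varphi_1(x)-\varphi(x))$ converges in distribution, as $n\to\infty$, to a non-degenerate distribution function $G$, then there are $\rho>0$ and $c>0$ such that $G(y)=\Psi_\rho(y/c)$ for all $y\in\mathbb R$; that is, $G$ is a reversed Weibull law up to scale, and with $c\,b_n$ in place of $b_n$ the limit is exactly $\Psi_\rho$. (ii) There exist $b_n>0$ such that $b_n^{-1}(\hat\varphi_1(x)-\varphi(x))$ converges in distribution to a non-degenerate limit if and only if $(\mathrm{RV}_\rho)$ holds for some $\rho>0$. More precisely, for each $\rho>0$ there exist $b_n>0$ such that the limit is $\Psi_\rho$ if and only if $(\mathrm{RV}_\rho)$ holds. In this case $b_n=\varphi(x)-\varphi_{1-1/(nF_X(x))}(x)$, which is positive for every $n\ge1$, can be chosen: with it, $b_n^{-1}(\hat\varphi_1(x)-\varphi(x))$ converges in distribution to $\Psi_\rho$. (iii) Let $\rho>0$, assume $(\mathrm{RV}_\rho)$, and let $b_n=\varphi(x)-\varphi_{1-1/(nF_X(x))}(x)$. Then all moments of $\hat\varphi_1(x)$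 are finite, $$\lim_{n\to\infty}\mathbb E\bigl[\{b_n^{-1}(\varphi(x)-\hat\varphi_1(x))\}^k\bigr]=\Gamma(1+k/\rho)\quad\text{for all integers }k\ge1,$$ $\operatorname{Var}(\hat\varphi_1(x))>0$ for every $n\ge1$, and for all $y\in\mathbb R$ $$\lim_{n\to\infty}\mathbb P\left[\frac{\hat\varphi_1(x)-\mathbb E(\hat\varphi_1(x))}{\{\operatorname{Var}(\hat\varphi_1(x))\}^{1/2}}\le y\right]=\Psi_\rho\Bigl[\bigl\{\Gamma(1+2/\rho)-\Gamma^2(1+1/\rho)\bigr\}^{1/2}y-\Gamma(1+1/\rho)\Bigr].$$ -/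

import Mathlib

open MeasureTheory ProbabilityTheory Filter Topology

noncomputable section

namespace FDH

variable {p : ℕ} {Ω : Type*} [MeasurableSpace Ω]

/-- The joint distribution function `F(x, y) = P(X ≤ x, Y ≤ y)` of a law `μ` on `ℝ^p × ℝ`;
the inequality `X ≤ x` is componentwise. -/
def jointCDF (μ : Measure ((Fin p → ℝ) × ℝ)) (x : Fin p → ℝ) (y : ℝ) : ℝ :=
  μ.real {q | q.1 ≤ x ∧ q.2 ≤ y}

/-- The marginal distribution function `F_X(x) = P(X ≤ x)`. -/
def marginalCDF (μ : Measure ((Fin p → ℝ) × ℝ)) (x : Fin p → ℝ) : ℝ :=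
  μ.real {q | q.1 ≤ x}

/-- The conditional distribution function `F(y | x) = F(x, y) / F_X(x)` of `Y` given `X ≤ x`. -/
def condDF (μ : Measure ((Fin p → ℝ) × ℝ)) (x : Fin p → ℝ) (y : ℝ) : ℝ :=
  jointCDF μ x y / marginalCDF μ x

/-- The frontier function `φ(x) = sup {y ≥ 0 | F(y | x) < 1}` (the supremum of the empty set being
`0`, and the set being assumed bounded where `φ` is used). -/
def frontier (μ : Measure ((Fin p → ℝ) × ℝ)) (x : Fin p → ℝ) : ℝ :=
  sSup {y | 0 ≤ y ∧ condDF μ x y < 1}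

/-- The conditional quantile `φ_α(x) = inf {y ≥ 0 | F(y | x) ≥ α}`. -/
def condQuantile (μ : Measure ((Fin p → ℝ) × ℝ)) (α : ℝ) (x : Fin p → ℝ) : ℝ :=
  sInf {y | 0 ≤ y ∧ α ≤ condDF μ x y}

open Classical in
/-- The FDH estimator `max {Y_i | i < n, X_i ≤ x}` built on the first `n` observations, with the
value `0` if there is no observation with `X_i ≤ x`. -/
def fdh (X : ℕ → Ω → Fin p → ℝ) (Y : ℕ → Ω → ℝ) (x : Fin p → ℝ) (n : ℕ) (ω : Ω) : ℝ :=
  if h : ((Finset.range n).filter fun i => X i ω ≤ x).Nonempty then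
    ((Finset.range n).filter fun i => X i ω ≤ x).sup' h fun i => Y i ω
  else 0

/-- The reversed Weibull distribution function `Ψ_ρ(y) = exp(-(-y)^ρ)` for `y ≤ 0`, and
`Ψ_ρ(y) = 1` for `y > 0`. -/
def revWeibull (ρ y : ℝ) : ℝ :=
  if y ≤ 0 then Real.exp (-(-y) ^ ρ) else 1

/-- `G` is a (proper) probability distribution function on `ℝ` and the random variables `U n`
converge in distribution to it. -/
def ConvergesInLaw (P : Measure Ω) [IsProbabilityMeasure P] (U : ℕ → Ω → ℝ) (G : ℝ → ℝ) : Prop :=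
  ∃ ν : ProbabilityMeasure ℝ, (∀ y, cdf (ν : Measure ℝ) y = G y) ∧
    TendstoInDistribution U atTop (id : ℝ → ℝ) (fun _ => P) (ν : Measure ℝ)

/-- `G` is not the distribution function of a constant. -/
def Nondegenerate (G : ℝ → ℝ) : Prop :=
  ¬ ∃ c : ℝ, ∀ y, G y = if c ≤ y then 1 else 0

/-- The function `U` is regularly varying at infinity with index `a`. -/
def RegVar (U : ℝ → ℝ) (a : ℝ) : Prop :=
  ∀ z : ℝ, 0 < z → Tendsto (fun t : ℝ => U (t * z) / U t) atTop (𝓝 (z ^ a))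

/-- The extreme value condition: `t ↦ 1 - F(φ(x) - 1/t | x)` is regularly varying with
index `-ρ`. -/
def TailCondition (μ : Measure ((Fin p → ℝ) × ℝ)) (x : Fin p → ℝ) (ρ : ℝ) : Prop :=
  RegVar (fun t => 1 - condDF μ x (frontier μ x - 1 / t)) (-ρ)

/-- The norming constants `b_n = φ(x) - φ_{1 - 1/(n F_X(x))}(x)`. -/
def norming (μ : Measure ((Fin p → ℝ) × ℝ)) (x : Fin p → ℝ) (n : ℕ) : ℝ :=
  frontier μ x - condQuantile μ (1 - 1 / (n * marginalCDF μ x)) x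

end FDH

end

/-! Write V(ε) = P(X ≤ x, Y > φ(x) - ε), which is `tail`. For φ(x) - ε ≥ 0 the estimator is at most
φ(x) - ε exactly when no observation falls in an event of probability V(ε), so this has probability
(1 - V(ε))^n. For φ(x) - ε < 0 the same formula is off by (1 - F_X(x))^n, which tends to 0. Every
limit question thus concerns (1 - V(b_n w))^n, and the limit is Ψ_ρ iff n V(b_n w) → w^ρ for all w >
0 (`convergesInLaw_revWeibull_iff`).

Part (i) is convergence of types without centering: comparing b_n with b_{⌊sn⌋} gives g(r w) =
g(w)^s for g(w) = G(-w) (`exists_scale_rpow_eq`). The map x ↦ log(-log g(e^x)) then turns changes of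
scale into additive shifts, and monotonicity makes it affine (`eq_affine_of_monotone_of_shift`).

In (ii), (RV_ρ) says that V is regularly varying at 0 with index ρ. A limit Ψ_ρ implies it by
inverting n ↦ b_n through n = ⌊1/V(ε)⌋ (`tendsto_div_of_tendsto_nat_mul`). Conversely, the quantile
constants satisfy n V(b_n) ≤ 1 < n V(ε) for b_n < ε < φ(x), whence n V(b_n) → 1
(`tendsto_nat_mul_norming`).

For (iii), a Potter bound n V(b_n w) ≥ c w^{ρ/2} dominates the tails of the normalized error by a
stretched exponential, so the layer-cake formula passes to the limit. The first two moments then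
identify the standardization, up to a moving threshold. -/

namespace FDH

/-! ### Weak convergence and distribution functions. -/

/-- Pointwise convergence of the distribution functions implies weak convergence. -/
lemma tendsto_probabilityMeasure_of_tendsto_real_Iic {μs : ℕ → ProbabilityMeasure ℝ}
    {ν : ProbabilityMeasure ℝ}
    (h : ∀ y, Tendsto (fun n => (μs n : Measure ℝ).real (Set.Iic y)) atTop
      (𝓝 ((ν : Measure ℝ).real (Set.Iic y)))) :
    Tendsto μs atTop (𝓝 ν) := by
  have hIoc : ∀ (κ : ProbabilityMeasure ℝ) (a b : ℝ), a < b → ((κ (Set.Ioc a b) : NNReal) : ℝ) =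
      (κ : Measure ℝ).real (Set.Iic b) - (κ : Measure ℝ).real (Set.Iic a) := by
    intro κ a b hab
    rw [← measureReal_sdiff (Set.Iic_subset_Iic.2 hab.le) measurableSet_Iic, Set.Iic_sdiff_Iic]
    rfl
  refine (isPiSystem_Ioc (id : ℝ → ℝ) id).tendsto_probabilityMeasure_of_tendsto_of_mem ?_ ?_ ?_
  · rintro s ⟨a, b, -, rfl⟩
    exact measurableSet_Ioc
  · intro u hu x hx
    obtain ⟨ε, hε, hsub⟩ := Metric.isOpen_iff.1 hu x hx
    refine ⟨Set.Ioc (x - ε / 2) (x + ε / 2), ⟨_, _, (by linarith : x - ε / 2 < x + ε / 2), rfl⟩,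
      Ioc_mem_nhds (by linarith) (by linarith), fun y hy => hsub ?_⟩
    rw [Metric.mem_ball, Real.dist_eq, abs_lt]
    constructor <;> linarith [hy.1, hy.2]
  · rintro s ⟨a, b, hab, rfl⟩
    rw [← NNReal.tendsto_coe]
    simp only [id, hIoc _ a b hab]
    exact (h b).sub (h a)

section Criteria

variable {Ω : Type*} [MeasurableSpace Ω] {P : Measure Ω} [IsProbabilityMeasure P]
  {U : ℕ → Ω → ℝ} {G : ℝ → ℝ}

lemma convergesInLaw_of_tendsto (hU : ∀ n, AEMeasurable (U n) P) (hmono : Monotone G)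
    (hcont : Continuous G) (h0 : Tendsto G atBot (𝓝 0)) (h1 : Tendsto G atTop (𝓝 1))
    (h : ∀ y, Tendsto (fun n => P.real {ω | U n ω ≤ y}) atTop (𝓝 (G y))) :
    ConvergesInLaw P U G := by
  let f : StieltjesFunction ℝ := ⟨G, hmono, fun x => hcont.continuousWithinAt⟩
  have hf : cdf f.measure = f := cdf_measure_stieltjesFunction f h0 h1
  have hprob : IsProbabilityMeasure f.measure := f.isProbabilityMeasure h0 h1
  have hfG : ∀ y, cdf f.measure y = G y := fun y => by rw [hf]
  refine ⟨⟨f.measure, hprob⟩, hfG, ?_⟩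
  change TendstoInDistribution U atTop (id : ℝ → ℝ) (fun _ => P) f.measure
  refine ⟨hU, aemeasurable_id, ?_⟩
  apply tendsto_probabilityMeasure_of_tendsto_real_Iic
  intro y
  simp only [ProbabilityMeasure.coe_mk, Measure.map_id]
  rw [← cdf_eq_real, hfG]
  refine (h y).congr fun n => ?_
  rw [map_measureReal_apply_of_aemeasurable (hU n) measurableSet_Iic]
  rfl

lemma ConvergesInLaw.monotone (h : ConvergesInLaw P U G) : Monotone G := by
  obtain ⟨ν, hν, -⟩ := h
  intro a b hab
  rw [← hν, ← hν]
  exact monotone_cdf _ hab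

lemma ConvergesInLaw.tendsto_atBot (h : ConvergesInLaw P U G) : Tendsto G atBot (𝓝 0) := by
  obtain ⟨ν, hν, -⟩ := h
  exact (tendsto_cdf_atBot _).congr hν

lemma ConvergesInLaw.tendsto_atTop (h : ConvergesInLaw P U G) : Tendsto G atTop (𝓝 1) := by
  obtain ⟨ν, hν, -⟩ := h
  exact (tendsto_cdf_atTop _).congr hν

lemma ConvergesInLaw.continuousWithinAt_Ici (h : ConvergesInLaw P U G) (y : ℝ) :
    ContinuousWithinAt G (Set.Ici y) y := by
  obtain ⟨ν, hν, -⟩ := h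
  rw [← funext hν]
  exact (cdf (ν : Measure ℝ)).right_continuous y

lemma ConvergesInLaw.tendsto (h : ConvergesInLaw P U G) {y : ℝ} (hy : ContinuousAt G y) :
    Tendsto (fun n => P.real {ω | U n ω ≤ y}) atTop (𝓝 (G y)) := by
  obtain ⟨ν, hν, hU⟩ := h
  have hcont : ContinuousAt (cdf (ν : Measure ℝ)) y := by rwa [funext hν]
  have hnull : (ν : Measure ℝ) (_root_.frontier (Set.Iic y)) = 0 := by
    rw [frontier_Iic, ← measure_cdf (ν : Measure ℝ), StieltjesFunction.measure_singleton,
      (cdf (ν : Measure ℝ)).mono.continuousWithinAt_Iio_iff_leftLim_eq.1 hcont.continuousWithinAt]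
    simp
  have := ProbabilityMeasure.tendsto_measure_of_null_frontier_of_tendsto' hU.tendsto
    (E := Set.Iic y) (by simpa using hnull)
  rw [← hν, cdf_eq_real]
  simp only [ProbabilityMeasure.coe_mk, Measure.map_id] at this
  have h2 := (ENNReal.tendsto_toReal (measure_ne_top _ _)).comp this
  refine h2.congr fun n => ?_
  simp only [Function.comp]
  rw [Measure.map_apply_of_aemeasurable (hU.forall_aemeasurable n) measurableSet_Iic]
  rfl

end Criteria

/-! ### Exponential limits and the functional equation of the limit law. -/

lemma tendsto_one_sub_pow_exp {v : ℕ → ℝ} {τ : ℝ}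
    (h : Tendsto (fun n : ℕ => n * v n) atTop (𝓝 τ)) :
    Tendsto (fun n => (1 - v n) ^ n) atTop (𝓝 (Real.exp (-τ))) := by
  have := Real.tendsto_one_add_pow_exp_of_tendsto (g := fun n => -v n) (t := -τ)
    (by simpa using h.neg)
  simpa [sub_eq_add_neg] using this

/-- Logarithms give `n * -log (1 - v n) → τ`, which forces `v n → 0`. The bounds `(1 - v) * -log (1
- v) ≤ v ≤ -log (1 - v)` then carry the limit over to `n * v n`. -/
lemma tendsto_nat_mul_of_tendsto_one_sub_pow {v : ℕ → ℝ} {τ : ℝ} (hv0 : ∀ n, 0 ≤ v n)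
    (hv1 : ∀ n, v n ≤ 1) (h : Tendsto (fun n => (1 - v n) ^ n) atTop (𝓝 (Real.exp (-τ)))) :
    Tendsto (fun n : ℕ => n * v n) atTop (𝓝 τ) := by
  have hlog : Tendsto (fun n : ℕ => n * -Real.log (1 - v n)) atTop (𝓝 τ) := by
    have := (h.log (Real.exp_pos _).ne').neg
    simpa [Real.log_pow] using this
  have hlt : ∀ᶠ n : ℕ in atTop, v n < 1 := by
    filter_upwards [h.eventually_ne (Real.exp_pos _).ne', eventually_ge_atTop 1] with n hn hn1
    refine lt_of_le_of_ne (hv1 n) fun h1 => hn ?_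
    rw [h1, sub_self, zero_pow (by omega)]
  have hlower : ∀ᶠ n : ℕ in atTop, v n ≤ -Real.log (1 - v n) := by
    filter_upwards [hlt] with n hn
    have := Real.log_le_sub_one_of_pos (sub_pos.2 hn)
    linarith
  have hupper : ∀ᶠ n : ℕ in atTop, (1 - v n) * -Real.log (1 - v n) ≤ v n := by
    filter_upwards [hlt] with n hn
    have h1 : 0 < 1 - v n := sub_pos.2 hn
    have := Real.one_sub_inv_le_log_of_pos h1
    have h2 : (1 - v n) * (1 - (1 - v n)⁻¹) ≤ (1 - v n) * Real.log (1 - v n) := by gcongr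
    rw [mul_sub, mul_inv_cancel₀ h1.ne'] at h2
    linarith
  have hv : Tendsto v atTop (𝓝 0) := by
    have hinv : Tendsto (fun n : ℕ => (n : ℝ)⁻¹ * (n * -Real.log (1 - v n))) atTop (𝓝 (0 * τ)) :=
      tendsto_inv_atTop_nhds_zero_nat.mul hlog
    rw [zero_mul] at hinv
    refine tendsto_of_tendsto_of_tendsto_of_le_of_le' tendsto_const_nhds hinv
      (Eventually.of_forall hv0) ?_
    filter_upwards [hlower, eventually_ge_atTop 1] with n hn hn1
    have : (n : ℝ) ≠ 0 := by positivity
    rwa [inv_mul_cancel_left₀ this]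
  have hlow : Tendsto (fun n : ℕ => (1 - v n) * (n * -Real.log (1 - v n))) atTop (𝓝 τ) := by
    simpa using ((tendsto_const_nhds (x := (1 : ℝ))).sub hv).mul hlog
  refine tendsto_of_tendsto_of_tendsto_of_le_of_le' hlow hlog ?_ ?_
  · filter_upwards [hupper] with n hn
    calc (1 - v n) * (n * -Real.log (1 - v n)) = n * ((1 - v n) * -Real.log (1 - v n)) := by ring
      _ ≤ n * v n := by gcongr
  · filter_upwards [hlower] with n hn
    gcongr

/-- A monotone function which gains `s` under a shift by `l s`, for every `s`, is affine. -/
lemma eq_affine_of_monotone_of_shift {f l : ℝ → ℝ} (hf : Monotone f)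
    (hfl : ∀ s x, f (x + l s) = f x + s) : 0 < l 1 ∧ ∀ x, f x = f 0 + x / l 1 := by
  have hpos : 0 < l 1 := by
    by_contra! hle
    have h1 := hfl 1 0
    have h2 := hf (show 0 + l 1 ≤ 0 by linarith)
    linarith
  have hiter : ∀ s (n : ℕ), f (n * l s) = f 0 + n * s := by
    intro s n
    induction n with
    | zero => simp
    | succ n ih =>
      have := hfl s (n * l s)
      push_cast
      rw [add_mul, one_mul, this, ih]
      ring
  have hl1 : ∀ s, 0 ≤ l s → s = l s / l 1 := by
    intro s hs
    -- Trapping `n * l s` between consecutive multiples of `l 1` and applying `f` traps `n * s`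
    -- between the same consecutive integers.
    have hbound : ∀ n : ℕ, |(n : ℝ) * (s - l s / l 1)| ≤ 1 := by
      intro n
      have hq : 0 ≤ n * l s / l 1 := by positivity
      have h1 := Nat.floor_le hq
      have h2 := Nat.lt_floor_add_one (n * l s / l 1)
      set k := ⌊n * l s / l 1⌋₊
      have h3 : f (k * l 1) ≤ f (n * l s) := hf ((le_div_iff₀ hpos).1 h1)
      have h4 : f (n * l s) ≤ f ((k + 1 : ℕ) * l 1) := by
        refine hf ?_
        push_cast
        exact ((div_lt_iff₀ hpos).1 h2).le
      rw [hiter, hiter] at h3 h4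
      push_cast at h4
      rw [mul_sub, ← mul_div_assoc, abs_le]
      constructor <;> linarith
    by_contra hne
    have hne' : 0 < |s - l s / l 1| := abs_pos.2 (sub_ne_zero.2 hne)
    obtain ⟨n, hn⟩ := exists_nat_gt (1 / |s - l s / l 1|)
    have := hbound n
    rw [abs_mul, Nat.abs_cast] at this
    rw [div_lt_iff₀ hne'] at hn
    linarith
  have hls : ∀ s, 0 ≤ s → l s = s * l 1 := by
    intro s hs
    rcases hs.eq_or_lt with rfl | hs
    -- A negative `l 0` would be a period of `f`; going far enough left along it, a further shift by
    -- `l 1` raises `f` above `f 0` while staying below `0`.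
    · rcases le_or_gt 0 (l 0) with h0 | h0
      · have := hl1 0 h0
        rw [eq_comm, div_eq_zero_iff] at this
        rcases this with h | h
        · simp [h]
        · exact absurd h hpos.ne'
      · exfalso
        obtain ⟨n, hn⟩ := exists_nat_gt (l 1 / -l 0)
        rw [div_lt_iff₀ (by linarith)] at hn
        have h1 := hfl 1 (n * l 0)
        have h2 := hiter 0 n
        have h3 := hf (show n * l 0 + l 1 ≤ 0 by linarith)
        rw [h1, h2] at h3
        linarith
    · have h0 : 0 ≤ l s := by
        by_contra! hneg
        have h1 := hfl s 0
        have h2 := hf (show 0 + l s ≤ 0 by linarith)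
        linarith
      have := hl1 s h0
      rw [eq_div_iff hpos.ne'] at this
      exact this.symm
  refine ⟨hpos, fun x => ?_⟩
  rcases le_total 0 x with hx | hx
  · have h1 := hls (x / l 1) (by positivity)
    have h2 := hfl (x / l 1) 0
    rw [h1, div_mul_cancel₀ _ hpos.ne', zero_add] at h2
    exact h2
  · have h1 := hls (-x / l 1) (div_nonneg (by linarith) hpos.le)
    have h2 := hfl (-x / l 1) x
    rw [h1, div_mul_cancel₀ _ hpos.ne', add_neg_cancel, neg_div] at h2
    linarith

/-- The solutions `g` of the equations `g (λ w) = g w ^ s`. -/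
lemma eq_exp_neg_rpow_of_rpow_eq {g : ℝ → ℝ} (hanti : AntitoneOn g (Set.Ioi 0))
    (h1 : ∀ w, 0 < w → g w ≤ 1)
    {w₀ : ℝ} (hw₀ : 0 < w₀) (hgw₀ : 0 < g w₀) (hgw₁ : g w₀ < 1)
    (hfun : ∀ s : ℝ, 0 < s → ∃ r, 0 < r ∧ ∀ w, 0 < w → g (r * w) = g w ^ s) :
    ∃ ρ : ℝ, 0 < ρ ∧ ∃ c : ℝ, 0 < c ∧ ∀ w, 0 < w → g w = Real.exp (-(w / c) ^ ρ) := by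
  choose! r hr hgr using hfun
  have hr2 : 1 < r 2 := by
    by_contra! hle
    have h2 := hgr 2 two_pos w₀ hw₀
    have h3 : g w₀ ≤ g (r 2 * w₀) := hanti (mul_pos (hr 2 two_pos) hw₀) hw₀
      (mul_le_of_le_one_left hw₀.le hle)
    rw [h2, Real.rpow_two] at h3
    nlinarith
  have hiter : ∀ n : ℕ, ∀ w, 0 < w → g (r 2 ^ n * w) = g w ^ (2 ^ n : ℕ) := by
    intro n
    induction n with
    | zero => intro w _; simp
    | succ n ih =>
      intro w hw
      rw [pow_succ, mul_assoc, ih _ (mul_pos (by linarith) hw), hgr 2 two_pos w hw, Real.rpow_two,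
        ← pow_mul]
      ring_nf
  -- Since `r 2 > 1`, iterated scaling by `r 2` reaches any distance while only squaring the value
  -- repeatedly, so `g` never hits `0`, nor `1` (next claim).
  have hgpos : ∀ w, 0 < w → 0 < g w := by
    intro w hw
    obtain ⟨n, hn⟩ := pow_unbounded_of_one_lt (w / w₀) hr2
    rw [div_lt_iff₀ hw₀] at hn
    have h2 : g (r 2 ^ n * w₀) ≤ g w := hanti hw (hw.trans hn) hn.le
    rw [hiter n w₀ hw₀] at h2
    exact lt_of_lt_of_le (pow_pos hgw₀ _) h2
  have hglt : ∀ w, 0 < w → g w < 1 := by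
    intro w hw
    obtain ⟨n, hn⟩ := pow_unbounded_of_one_lt (w₀ / w) hr2
    rw [div_lt_iff₀ hw] at hn
    have h2 : g (r 2 ^ n * w) ≤ g w₀ := hanti hw₀ (hw₀.trans hn) hn.le
    rw [hiter n w hw] at h2
    refine lt_of_le_of_ne (h1 w hw) fun h => ?_
    rw [h, one_pow] at h2
    linarith
  set f : ℝ → ℝ := fun x => Real.log (-Real.log (g (Real.exp x))) with hf
  have hlogneg : ∀ w, 0 < w → 0 < -Real.log (g w) := fun w hw =>
    neg_pos.2 (Real.log_neg (hgpos w hw) (hglt w hw))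
  have hmono : Monotone f := by
    intro x y hxy
    refine Real.log_le_log (hlogneg _ (Real.exp_pos _)) (neg_le_neg ?_)
    exact Real.log_le_log (hgpos _ (Real.exp_pos _))
      (hanti (Real.exp_pos _) (Real.exp_pos _) (Real.exp_le_exp.2 hxy))
  have hshift : ∀ s x, f (x + Real.log (r (Real.exp s))) = f x + s := by
    intro s x
    have hrs := hr _ (Real.exp_pos s)
    simp only [hf]
    rw [Real.exp_add, Real.exp_log hrs, mul_comm, hgr _ (Real.exp_pos s) _ (Real.exp_pos x),
      Real.log_rpow (hgpos _ (Real.exp_pos x)), ← mul_neg,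
      Real.log_mul (Real.exp_pos s).ne' (hlogneg _ (Real.exp_pos _)).ne', Real.log_exp, add_comm]
  obtain ⟨hl, haff⟩ := eq_affine_of_monotone_of_shift
    (l := fun s => Real.log (r (Real.exp s))) hmono hshift
  set L := Real.log (r (Real.exp 1))
  have hL : 0 < L := hl
  -- Solved from `log (-log (g w)) = f 0 + log w / L = (log w - log c) / L`.
  refine ⟨1 / L, by positivity, Real.exp (-(f 0 * L)), Real.exp_pos _, fun w hw => ?_⟩
  have h2 := haff (Real.log w)
  simp only [hf] at h2
  rw [Real.exp_log hw] at h2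
  have h3 : -Real.log (g w) = Real.exp (f 0 + Real.log w / L) := by
    rw [← Real.exp_log (hlogneg w hw), h2]
  have h4 : (w / Real.exp (-(f 0 * L))) ^ (1 / L) = Real.exp (f 0 + Real.log w / L) := by
    rw [Real.rpow_def_of_pos (by positivity), Real.log_div hw.ne' (Real.exp_pos _).ne',
      Real.log_exp]
    congr 1
    field_simp
    ring
  rw [h4, ← h3, neg_neg, Real.exp_log (hgpos w hw)]

/-! ### Convergence of types. -/

/-- Convergence of types for maxima with scaling only: the limit `g` of
`(1 - V (b n * w)) ^ n` is stable under powers, up to a change of scale. -/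
lemma exists_scale_rpow_eq {V g : ℝ → ℝ} {b : ℕ → ℝ} {D : Set ℝ} (hV : Monotone V)
    (hV1 : ∀ ε, V ε ≤ 1) (hb : ∀ n, 1 ≤ n → 0 < b n)
    (hanti : AntitoneOn g (Set.Ioi 0)) (h0 : ∀ w, 0 < w → 0 ≤ g w)
    (hleft : ∀ a w c, 0 ≤ a → a < w → g w < c → ∃ u ∈ D, a < u ∧ u < w ∧ g u < c)
    (htop : Tendsto g atTop (𝓝 0))
    (hlim : ∀ w ∈ D, 0 < w → Tendsto (fun n => (1 - V (b n * w)) ^ n) atTop (𝓝 (g w)))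
    {w₀ : ℝ} (hw₀ : 0 < w₀) (hw₀D : w₀ ∈ D) (hgw₀ : 0 < g w₀) {s : ℝ} (hs : 0 < s) :
    ∃ r, 0 < r ∧ ∀ w, 0 < w → g (r * w) = g w ^ s := by
  set N : ℕ → ℕ := fun n => ⌊s * n⌋₊ with hN
  have hNtop : Tendsto N atTop atTop :=
    tendsto_nat_floor_atTop.comp (tendsto_natCast_atTop_atTop.const_mul_atTop hs)
  have hNdiv : Tendsto (fun n : ℕ => (N n : ℝ) / n) atTop (𝓝 s) :=
    (tendsto_nat_floor_mul_div_atTop hs.le).comp tendsto_natCast_atTop_atTop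
  -- Raise the `n`-th power to the exponent `N n / n → s`. The same sequence of exponents `N n` also
  -- gives `g w` at scale `b (N n)`, in `hF`; the two limits are compared through the ratio `q`.
  have hE : ∀ w ∈ D, 0 < w →
      Tendsto (fun n => (1 - V (b n * w)) ^ N n) atTop (𝓝 (g w ^ s)) := by
    intro w hw hw0
    refine ((hlim w hw hw0).rpow hNdiv (Or.inr hs)).congr' ?_
    filter_upwards [eventually_ge_atTop 1] with n hn
    have hn0 : (n : ℝ) ≠ 0 := by positivity
    rw [← Real.rpow_natCast, ← Real.rpow_mul (sub_nonneg.2 (hV1 _)), mul_div_cancel₀ _ hn0,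
      Real.rpow_natCast]
  have hF : ∀ w ∈ D, 0 < w → Tendsto (fun n => (1 - V (b (N n) * w)) ^ N n) atTop (𝓝 (g w)) :=
    fun w hw hw0 => (hlim w hw hw0).comp hNtop
  set q : ℕ → ℝ := fun n => b n / b (N n) with hq
  have hev : ∀ᶠ n in atTop, 0 < b n ∧ 0 < b (N n) := by
    filter_upwards [eventually_ge_atTop 1, hNtop.eventually_ge_atTop 1] with n h1 h2
    exact ⟨hb _ h1, hb _ h2⟩
  have hle : ∀ u ∈ D, ∀ w ∈ D, 0 < u → 0 < w → (∃ᶠ n in atTop, q n * w ≤ u) →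
      g u ≤ g w ^ s := by
    intro u hu w hw hu0 hw0 hfreq
    refine le_of_tendsto_of_tendsto_of_frequently (hF u hu hu0) (hE w hw hw0) ?_
    refine (hfreq.and_eventually hev).mono fun n ⟨hn, _, hbN⟩ => ?_
    refine pow_le_pow_left₀ (sub_nonneg.2 (hV1 _)) (sub_le_sub_left (hV ?_) 1) _
    rw [hq, div_mul_eq_mul_div, div_le_iff₀ hbN] at hn
    linarith
  have hge : ∀ u ∈ D, ∀ w ∈ D, 0 < u → 0 < w → (∃ᶠ n in atTop, u ≤ q n * w) →
      g w ^ s ≤ g u := by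
    intro u hu w hw hu0 hw0 hfreq
    refine le_of_tendsto_of_tendsto_of_frequently (hE w hw hw0) (hF u hu hu0) ?_
    refine (hfreq.and_eventually hev).mono fun n ⟨hn, _, hbN⟩ => ?_
    refine pow_le_pow_left₀ (sub_nonneg.2 (hV1 _)) (sub_le_sub_left (hV ?_) 1) _
    rw [hq, div_mul_eq_mul_div, le_div_iff₀ hbN] at hn
    linarith
  have hfar : ∀ c, 0 < c → ∃ w ∈ D, 0 < w ∧ g w < c := by
    intro c hc
    obtain ⟨A, hA⟩ := eventually_atTop.1 ((tendsto_order.1 htop).2 c hc)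
    obtain ⟨u, hu, h1, h2, h3⟩ := hleft (max A 0) (max A 0 + 1) c (le_max_right _ _)
      (by linarith) (hA _ (by linarith [le_max_left A 0]))
    exact ⟨u, hu, lt_of_le_of_lt (le_max_right _ _) h1, h3⟩
  -- If `q` were frequently too large, `hge` would bound `g w₀ ^ s > 0` by a value of `g` chosen
  -- smaller than it, far out.
  have hupper : ∃ R, ∀ᶠ n in atTop, q n ≤ R := by
    obtain ⟨w₁, hw₁D, hw₁, hgw₁⟩ := hfar (g w₀ ^ s) (Real.rpow_pos_of_pos hgw₀ s)
    refine ⟨w₁ / w₀, ?_⟩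
    by_contra hcon
    rw [not_eventually] at hcon
    refine absurd (hge w₁ hw₁D w₀ hw₀D hw₁ hw₀ (hcon.mono fun n hn => ?_)) (not_le.2 hgw₁)
    rw [not_le, div_lt_iff₀ hw₀] at hn
    exact hn.le
  have hlower : ∃ r, 0 < r ∧ ∀ᶠ n in atTop, r ≤ q n := by
    obtain ⟨w₁, hw₁D, hw₁, hgw₁⟩ := hfar (g w₀ ^ (1 / s)) (Real.rpow_pos_of_pos hgw₀ _)
    have hlt : g w₁ ^ s < g w₀ := by
      have := Real.rpow_lt_rpow (h0 _ hw₁) hgw₁ hs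
      rwa [← Real.rpow_mul hgw₀.le, one_div_mul_cancel hs.ne', Real.rpow_one] at this
    refine ⟨w₀ / w₁, by positivity, ?_⟩
    by_contra hcon
    rw [not_eventually] at hcon
    refine absurd (hle w₀ hw₀D w₁ hw₁D hw₀ hw₁ (hcon.mono fun n hn => ?_)) (not_le.2 hlt)
    rw [not_le, lt_div_iff₀ hw₁] at hn
    exact hn.le
  obtain ⟨R, hR⟩ := hupper
  obtain ⟨r₀, hr₀, hr⟩ := hlower
  obtain ⟨r, hrmem, φ, hφ, hlimr⟩ := (isCompact_Icc (a := r₀) (b := R)).tendsto_subseq'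
    (x := q) ((hr.and hR).frequently)
  have hrpos : 0 < r := lt_of_lt_of_le hr₀ hrmem.1
  -- Only a subsequence of `q` converges to `r`, but `hle` and `hge` ask for frequent inequalities
  -- only. `hleft` supplies points of `D` slightly to the left, so that the comparisons with `r` are
  -- strict and survive the limit.
  refine ⟨r, hrpos, fun w hw => le_antisymm ?_ ?_⟩
  · by_contra! hlt
    have hcont : Tendsto (fun x : ℝ => x ^ s) (𝓝 (g w)) (𝓝 (g w ^ s)) :=
      (Real.continuousAt_rpow_const _ _ (Or.inr hs.le)).tendsto
    obtain ⟨δ, hδ, hball⟩ := Metric.eventually_nhds_iff.1 ((tendsto_order.1 hcont).2 _ hlt)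
    obtain ⟨u, hu, hu0, huw, hgu⟩ := hleft 0 w (g w + δ) le_rfl hw (by linarith)
    have hgwu : g w ≤ g u := hanti hu0 hw huw.le
    have hgus : g u ^ s < g (r * w) := hball (by
      rw [Real.dist_eq, abs_lt]
      constructor <;> linarith)
    obtain ⟨v, hv, hv1, hv2, -⟩ := hleft (r * u) (r * w) (g (r * w) + 1) (by positivity)
      (by gcongr) (by linarith)
    have hv0 : 0 < v := lt_of_le_of_lt (by positivity) hv1
    have h1 := hle v hv u hu hv0 hu0 (by
      have : ∀ᶠ n in atTop, q (φ n) * u < v := (tendsto_order.1 (hlimr.mul_const u)).2 _ hv1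
      exact hφ.tendsto_atTop.frequently (this.mono fun n hn => hn.le).frequently)
    have h2 : g (r * w) ≤ g v := hanti hv0 (mul_pos hrpos hw) hv2.le
    linarith
  · by_contra! hlt
    obtain ⟨u, hu, hu0, huw, hgu⟩ := hleft 0 (r * w) (g w ^ s) le_rfl (by positivity) hlt
    obtain ⟨v, hv, hv1, hv2, -⟩ := hleft (u / r) w (g w + 1) (by positivity)
      (by rw [div_lt_iff₀ hrpos]; linarith) (by linarith)
    have hv0 : 0 < v := lt_of_le_of_lt (by positivity) hv1
    have h1 := hge u hu v hv hu0 hv0 (by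
      have : ∀ᶠ n in atTop, u < q (φ n) * v := (tendsto_order.1 (hlimr.mul_const v)).1 _ (by
        rw [div_lt_iff₀ hrpos] at hv1; linarith)
      exact hφ.tendsto_atTop.frequently (this.mono fun n hn => hn.le).frequently)
    have h2 : g w ^ s ≤ g v ^ s := Real.rpow_le_rpow (h0 _ hw) (hanti hv0 hw hv2.le) hs.le
    linarith

/-! ### Regular variation at zero and norming constants. -/

/-- A monotone function with vanishing right limit at `0` that is asymptotic, along the scales
`b n`, to `w ↦ w ^ ρ / n`, is regularly varying at `0` with index `ρ`. -/
lemma tendsto_div_of_tendsto_nat_mul {V : ℝ → ℝ} {b : ℕ → ℝ} {ρ : ℝ} (hV : Monotone V)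
    (hpos : ∀ ε, 0 < ε → 0 < V ε) (hb : ∀ n, 1 ≤ n → 0 < b n)
    (hlim : ∀ w, 0 < w → Tendsto (fun n : ℕ => n * V (b n * w)) atTop (𝓝 (w ^ ρ)))
    (hρ : 0 < ρ) {z : ℝ} (hz : 0 < z) :
    Tendsto (fun ε => V (ε * z) / V ε) (𝓝[>] 0) (𝓝 (z ^ ρ)) := by
  have hV0 : Tendsto V (𝓝[>] 0) (𝓝[>] 0) := by
    refine tendsto_nhdsWithin_iff.2 ⟨?_, by
      filter_upwards [self_mem_nhdsWithin] with ε hε using hpos ε hε⟩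
    rw [tendsto_order]
    refine ⟨fun c hc => ?_, fun c hc => ?_⟩
    · filter_upwards [self_mem_nhdsWithin] with ε hε using hc.trans (hpos ε hε)
    · have h1 : Tendsto (fun n : ℕ => (n : ℝ)⁻¹ * (n * V (b n * 1))) atTop (𝓝 (0 * 1 ^ ρ)) :=
        tendsto_inv_atTop_nhds_zero_nat.mul (hlim 1 one_pos)
      rw [zero_mul] at h1
      obtain ⟨n, hn, hn1⟩ := (((tendsto_order.1 h1).2 c hc).and (eventually_ge_atTop 1)).exists
      have hn0 : (n : ℝ) ≠ 0 := by positivity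
      rw [inv_mul_cancel_left₀ hn0, mul_one] at hn
      filter_upwards [Ioo_mem_nhdsGT (hb n hn1)] with ε hε
      exact lt_of_le_of_lt (hV hε.2.le) hn
  -- The sample size matching `ε`: as `N ε * V ε → 1`, monotonicity of `V` and strict monotonicity
  -- of `w ↦ w ^ ρ` at `1` place `ε` between `b (N ε) * (1 - δ)` and `b (N ε) * (1 + δ)`.
  set N : ℝ → ℕ := fun ε => ⌊(V ε)⁻¹⌋₊ with hN
  have hinv : Tendsto (fun ε => (V ε)⁻¹) (𝓝[>] 0) atTop := tendsto_inv_nhdsGT_zero.comp hV0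
  have hNtop : Tendsto N (𝓝[>] 0) atTop := tendsto_nat_floor_atTop.comp hinv
  have hNV : Tendsto (fun ε => N ε * V ε) (𝓝[>] 0) (𝓝 1) := by
    refine ((tendsto_nat_floor_div_atTop (R := ℝ)).comp hinv).congr fun ε => ?_
    simp [hN, div_eq_mul_inv]
  have hnum : Tendsto (fun ε => N ε * V (ε * z)) (𝓝[>] 0) (𝓝 (z ^ ρ)) := by
    have hsq : ∀ δ : ℝ, 0 < δ → δ < 1 → ∀ᶠ ε in 𝓝[>] 0,
        N ε * V (b (N ε) * ((1 - δ) * z)) ≤ N ε * V (ε * z) ∧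
          N ε * V (ε * z) ≤ N ε * V (b (N ε) * ((1 + δ) * z)) := by
      intro δ hδ hδ1
      have h1 : ∀ᶠ ε in 𝓝[>] 0, N ε * V (b (N ε) * (1 - δ)) < N ε * V ε :=
        Tendsto.eventually_lt ((hlim (1 - δ) (by linarith)).comp hNtop) hNV
          (Real.rpow_lt_one (by linarith) (by linarith) hρ)
      have h2 : ∀ᶠ ε in 𝓝[>] 0, N ε * V ε < N ε * V (b (N ε) * (1 + δ)) :=
        Tendsto.eventually_lt hNV ((hlim (1 + δ) (by linarith)).comp hNtop)
          (Real.one_lt_rpow (by linarith) hρ)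
      filter_upwards [h1, h2] with ε h1 h2
      have h3 : b (N ε) * (1 - δ) < ε := hV.reflect_lt (lt_of_mul_lt_mul_left h1 (by positivity))
      have h4 : ε < b (N ε) * (1 + δ) := hV.reflect_lt (lt_of_mul_lt_mul_left h2 (by positivity))
      constructor
      · refine mul_le_mul_of_nonneg_left (hV ?_) (by positivity)
        rw [← mul_assoc]
        gcongr
      · refine mul_le_mul_of_nonneg_left (hV ?_) (by positivity)
        rw [← mul_assoc]
        gcongr
    have hcont : ∀ σ : ℝ, Tendsto (fun δ : ℝ => ((1 + σ * δ) * z) ^ ρ) (𝓝[>] 0) (𝓝 (z ^ ρ)) := by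
      intro σ
      have : ContinuousAt (fun δ : ℝ => ((1 + σ * δ) * z) ^ ρ) 0 :=
        ContinuousAt.rpow_const (by fun_prop) (Or.inr hρ.le)
      have h2 := this.tendsto
      simp only [mul_zero, add_zero, one_mul] at h2
      exact h2.mono_left nhdsWithin_le_nhds
    have hsmall : ∀ᶠ δ : ℝ in 𝓝[>] 0, 0 < δ ∧ δ < 1 := Ioo_mem_nhdsGT one_pos
    rw [tendsto_order]
    constructor
    · intro c hc
      obtain ⟨δ, hδc, hδ0, hδ1⟩ := (((tendsto_order.1 (hcont (-1))).1 c hc).and hsmall).exists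
      have h1 := (tendsto_order.1 ((hlim ((1 - δ) * z)
        (mul_pos (by linarith) hz)).comp hNtop)).1 c (by
          rwa [neg_one_mul, ← sub_eq_add_neg] at hδc)
      filter_upwards [h1, hsq δ hδ0 hδ1] with ε h1 h2
      exact lt_of_lt_of_le h1 h2.1
    · intro c hc
      obtain ⟨δ, hδc, hδ0, hδ1⟩ := (((tendsto_order.1 (hcont 1)).2 c hc).and hsmall).exists
      have h1 := (tendsto_order.1 ((hlim ((1 + δ) * z)
        (mul_pos (by linarith) hz)).comp hNtop)).2 c (by rwa [one_mul] at hδc)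
      filter_upwards [h1, hsq δ hδ0 hδ1] with ε h1 h2
      exact lt_of_le_of_lt h2.2 h1
  have hdiv := hnum.div hNV one_ne_zero
  rw [div_one] at hdiv
  refine hdiv.congr' ?_
  filter_upwards [hNtop.eventually_ge_atTop 1] with ε hε
  have hn0 : (N ε : ℝ) ≠ 0 := by positivity
  exact mul_div_mul_left _ _ hn0

/-- A monotone function of positive index of regular variation at `0` vanishes at `0+`. -/
lemma tendsto_zero_of_tendsto_div {V : ℝ → ℝ} {ρ : ℝ} (hV : Monotone V)
    (hpos : ∀ ε, 0 < ε → 0 < V ε) (hρ : 0 < ρ)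
    (hreg : ∀ z, 0 < z → Tendsto (fun ε => V (ε * z) / V ε) (𝓝[>] 0) (𝓝 (z ^ ρ))) :
    Tendsto V (𝓝[>] 0) (𝓝 0) := by
  have hlim := hV.tendsto_nhdsGT 0
  set L := sInf (V '' Set.Ioi 0)
  have hL : 0 ≤ L := Real.sInf_nonneg (by rintro _ ⟨ε, hε, rfl⟩; exact (hpos ε hε).le)
  rcases hL.eq_or_lt with h | h
  · rwa [← h] at hlim
  · exfalso
    have hscale : Tendsto (fun ε : ℝ => ε * 2) (𝓝[>] 0) (𝓝[>] 0) := by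
      refine tendsto_nhdsWithin_iff.2 ⟨?_, ?_⟩
      · have : Tendsto (fun ε : ℝ => ε * 2) (𝓝 0) (𝓝 (0 * 2)) := tendsto_id.mul_const 2
        rw [zero_mul] at this
        exact this.mono_left nhdsWithin_le_nhds
      · filter_upwards [self_mem_nhdsWithin] with ε hε
        exact mul_pos (Set.mem_Ioi.1 hε) two_pos
    have h1 := (hlim.comp hscale).div hlim h.ne'
    rw [div_self h.ne'] at h1
    have h2 := tendsto_nhds_unique h1 (hreg 2 two_pos)
    have h3 := Real.one_lt_rpow (one_lt_two) hρ
    linarith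

/-- Norming constants `b n` with `V (b n) ≤ 1 / n`, which are optimal in that respect, tend
to `0`. -/
lemma tendsto_nhdsGT_zero_of_nat_mul_le {V : ℝ → ℝ} {b : ℕ → ℝ} (hV : Monotone V)
    (hpos : ∀ ε, 0 < ε → 0 < V ε) (hb : ∀ n, 1 ≤ n → 0 < b n)
    (hle : ∀ n, 1 ≤ n → n * V (b n) ≤ 1) :
    Tendsto b atTop (𝓝[>] 0) := by
  have hbpos : ∀ᶠ n in atTop, 0 < b n := by
    filter_upwards [eventually_ge_atTop 1] with n hn using hb n hn
  refine tendsto_nhdsWithin_iff.2 ⟨tendsto_order.2 ⟨fun c hc => ?_, fun c hc => ?_⟩, hbpos⟩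
  · filter_upwards [hbpos] with n hn using hc.trans hn
  · obtain ⟨m, hm⟩ := exists_nat_gt (1 / V c)
    filter_upwards [eventually_ge_atTop (max m 1)] with n hn
    have hmn : (m : ℝ) ≤ n := by exact_mod_cast (le_max_left _ _).trans hn
    rw [div_lt_iff₀ (hpos c hc)] at hm
    refine hV.reflect_lt ?_
    have h1 := hle n ((le_max_right _ _).trans hn)
    have h2 : (m : ℝ) * V c ≤ n * V c := by gcongr; exact (hpos c hc).le
    exact lt_of_mul_lt_mul_left (lt_of_le_of_lt h1 (lt_of_lt_of_le hm h2)) (by positivity)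

/-- For `z > 1` the point `b n * z` lies beyond `b n`, so `n * V (b n * z) > 1`; regular variation
turns this into a lower bound for `n * V (b n)` close to `z ^ (-ρ)`, and `z` decreases to `1`. -/
lemma tendsto_nat_mul_norming {V : ℝ → ℝ} {b : ℕ → ℝ} {ρ φ : ℝ}
    (hpos : ∀ ε, 0 < ε → 0 < V ε) (hρ : 0 < ρ) (hφ : 0 < φ)
    (hreg : ∀ z, 0 < z → Tendsto (fun ε => V (ε * z) / V ε) (𝓝[>] 0) (𝓝 (z ^ ρ)))
    (hb : Tendsto b atTop (𝓝[>] 0)) (hle : ∀ n, 1 ≤ n → n * V (b n) ≤ 1)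
    (hlt : ∀ n, 1 ≤ n → ∀ ε, b n < ε → ε < φ → 1 < n * V ε) :
    Tendsto (fun n : ℕ => n * V (b n)) atTop (𝓝 1) := by
  have hbpos : ∀ᶠ n in atTop, 0 < b n := (tendsto_nhdsWithin_iff.1 hb).2
  rw [tendsto_order]
  constructor
  · intro c hc
    have hc' : ∀ᶠ z : ℝ in 𝓝[>] 1, c * z ^ ρ < 1 := by
      have : ContinuousAt (fun z : ℝ => c * z ^ ρ) 1 :=
        continuousAt_const.mul (Real.continuousAt_rpow_const _ _ (Or.inr hρ.le))
      refine nhdsWithin_le_nhds ((tendsto_order.1 this.tendsto).2 1 ?_)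
      simpa using hc
    obtain ⟨z, hcz, hz⟩ := (hc'.and self_mem_nhdsWithin).exists
    have hz0 : (0 : ℝ) < z := one_pos.trans hz
    have h1 : Tendsto (fun n => c * (V (b n * z) / V (b n))) atTop (𝓝 (c * z ^ ρ)) :=
      ((hreg z hz0).comp hb).const_mul c
    have h2 : ∀ᶠ n in atTop, b n < φ / z :=
      (tendsto_nhdsWithin_iff.1 hb).1.eventually_lt_const (by positivity)
    filter_upwards [(tendsto_order.1 h1).2 1 hcz, h2, hbpos, eventually_ge_atTop 1]
      with n h1 h2 h3 hn
    rw [lt_div_iff₀ hz0] at h2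
    have h4 := hlt n hn (b n * z) (lt_mul_of_one_lt_right h3 hz) h2
    have h5 := hpos (b n) h3
    have h6 := hpos (b n * z) (by positivity)
    rw [← mul_div_assoc, div_lt_one h5] at h1
    by_contra! hcon
    have h7 : n * V (b n) * V (b n * z) ≤ c * V (b n * z) := by gcongr
    nlinarith
  · intro c hc
    filter_upwards [eventually_ge_atTop 1] with n hn using lt_of_le_of_lt (hle n hn) hc

lemma tendsto_nat_mul_rpow {V : ℝ → ℝ} {b : ℕ → ℝ} {ρ : ℝ}
    (hpos : ∀ ε, 0 < ε → 0 < V ε)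
    (hreg : ∀ z, 0 < z → Tendsto (fun ε => V (ε * z) / V ε) (𝓝[>] 0) (𝓝 (z ^ ρ)))
    (hb : Tendsto b atTop (𝓝[>] 0))
    (h1 : Tendsto (fun n : ℕ => n * V (b n)) atTop (𝓝 1)) {w : ℝ} (hw : 0 < w) :
    Tendsto (fun n : ℕ => n * V (b n * w)) atTop (𝓝 (w ^ ρ)) := by
  have h2 := h1.mul ((hreg w hw).comp hb)
  rw [one_mul] at h2
  refine h2.congr' ?_
  filter_upwards [(tendsto_nhdsWithin_iff.1 hb).2] with n hn
  have := (hpos _ hn).ne'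
  simp only [Function.comp]
  field_simp

/-- A lower Potter bound along the norming constants. -/
lemma exists_potter_bound {V : ℝ → ℝ} {b : ℕ → ℝ} {ρ φ : ℝ} (hV : Monotone V)
    (hpos : ∀ ε, 0 < ε → 0 < V ε) (hρ : 0 < ρ) (hφ : 0 < φ)
    (hreg : ∀ z, 0 < z → Tendsto (fun ε => V (ε * z) / V ε) (𝓝[>] 0) (𝓝 (z ^ ρ)))
    (hb : Tendsto b atTop (𝓝[>] 0))
    (h1 : Tendsto (fun n : ℕ => n * V (b n)) atTop (𝓝 1)) :
    ∃ c, 0 < c ∧ ∀ᶠ n : ℕ in atTop, ∀ w, 1 ≤ w → b n * w ≤ φ →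
      c * w ^ (ρ / 2) ≤ n * V (b n * w) := by
  set q := ρ / 2 with hq
  have hq0 : 0 < q := by positivity
  -- Halving the exponent leaves room: doubling `ε` multiplies `V` by about `2 ^ ρ > 2 ^ q`.
  -- Iterating gives growth along powers of two, and rounding to a power of two costs the factor `(1
  -- / 2) ^ q` in `hgrow`.
  have hdouble : ∀ᶠ ε in 𝓝[>] 0, 2 ^ q * V ε ≤ V (ε * 2) := by
    have hlt : (2 : ℝ) ^ q < 2 ^ ρ := Real.rpow_lt_rpow_of_exponent_lt one_lt_two (by linarith)
    filter_upwards [(tendsto_order.1 (hreg 2 two_pos)).1 _ hlt, self_mem_nhdsWithin] with ε h h0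
    exact ((lt_div_iff₀ (hpos ε h0)).1 h).le
  obtain ⟨ε₀, hε₀, hsub⟩ := mem_nhdsGT_iff_exists_Ioc_subset.1 hdouble
  have hε₀' : (0 : ℝ) < ε₀ := hε₀
  have hiter : ∀ j : ℕ, ∀ ε, 0 < ε → ε * 2 ^ j ≤ ε₀ → (2 ^ q) ^ j * V ε ≤ V (ε * 2 ^ j) := by
    intro j
    induction j with
    | zero => intro ε _ _; simp
    | succ j ih =>
      intro ε hε hle
      have hle' : ε * 2 ^ j ≤ ε₀ := by
        refine le_trans ?_ hle
        gcongr
        · norm_num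
        · omega
      have h2 := ih ε hε hle'
      have h3 : 2 ^ q * V (ε * 2 ^ j) ≤ V (ε * 2 ^ j * 2) := hsub ⟨by positivity, hle'⟩
      rw [pow_succ (2 : ℝ) j, ← mul_assoc]
      refine le_trans ?_ h3
      rw [pow_succ, mul_comm _ ((2 : ℝ) ^ q), mul_assoc]
      gcongr
  have hgrow : ∀ ε z, 0 < ε → 1 ≤ z → ε * z ≤ ε₀ → (z / 2) ^ q * V ε ≤ V (ε * z) := by
    intro ε z hε hz hle
    obtain ⟨j, hj1, hj2⟩ := exists_nat_pow_near hz one_lt_two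
    have h2 := hiter j ε hε (le_trans (by gcongr) hle)
    have h3 : (z / 2) ^ q ≤ (2 ^ q) ^ j := by
      rw [← Real.rpow_natCast, ← Real.rpow_mul two_pos.le, mul_comm q, Real.rpow_mul two_pos.le,
        Real.rpow_natCast]
      refine Real.rpow_le_rpow (by positivity) ?_ hq0.le
      rw [pow_succ] at hj2
      linarith
    calc (z / 2) ^ q * V ε ≤ (2 ^ q) ^ j * V ε := by gcongr; exact (hpos ε hε).le
      _ ≤ V (ε * 2 ^ j) := h2
      _ ≤ V (ε * z) := hV (by gcongr)
  -- Doubling is known only up to `ε₀`, while `b n * w` may reach `φ`. Shrinking `w` by `κ` brings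
  -- it below `ε₀`, and monotonicity of `V` covers the rest.
  set κ := min 1 (ε₀ / φ) with hκ
  have hκ0 : 0 < κ := lt_min one_pos (by positivity)
  refine ⟨(κ / 2) ^ q * (1 / 2), by positivity, ?_⟩
  have h2 : ∀ᶠ n in atTop, b n < ε₀ := (tendsto_nhdsWithin_iff.1 hb).1.eventually_lt_const hε₀'
  filter_upwards [(tendsto_nhdsWithin_iff.1 hb).2, h2, (tendsto_order.1 h1).1 (1 / 2) (by norm_num)]
    with n hn0 hn1 hn2 w hw hwφ
  have hn0' : 0 < b n := hn0
  have hle : b n * max 1 (κ * w) ≤ ε₀ := by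
    rw [mul_max_of_nonneg _ _ hn0'.le]
    refine max_le (by linarith) ?_
    calc b n * (κ * w) = κ * (b n * w) := by ring
      _ ≤ (ε₀ / φ) * φ := by
        gcongr
        exact min_le_right _ _
      _ = ε₀ := div_mul_cancel₀ _ hφ.ne'
  have h3 := hgrow (b n) _ hn0' (le_max_left 1 (κ * w)) hle
  have h4 : (κ / 2) ^ q * w ^ q ≤ (max 1 (κ * w) / 2) ^ q := by
    rw [← Real.mul_rpow (by positivity) (by positivity)]
    refine Real.rpow_le_rpow (by positivity) ?_ hq0.le
    have := le_max_right 1 (κ * w)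
    linarith
  have h5 : V (b n * max 1 (κ * w)) ≤ V (b n * w) := by
    refine hV (mul_le_mul_of_nonneg_left (max_le hw ?_) hn0'.le)
    exact mul_le_of_le_one_left (by linarith) (min_le_left _ _)
  calc (κ / 2) ^ q * (1 / 2) * w ^ q = (κ / 2) ^ q * w ^ q * (1 / 2) := by ring
    _ ≤ (max 1 (κ * w) / 2) ^ q * (n * V (b n)) := by gcongr
    _ = n * ((max 1 (κ * w) / 2) ^ q * V (b n)) := by ring
    _ ≤ n * V (b n * w) := by gcongr; exact h3.trans h5

/-! ### Moments from tails. -/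

/-- The closed form of the integral is positive, whereas a non-integrable function has integral `0`
by convention. -/
lemma integrableOn_rpow_mul_exp_neg_mul_rpow' {q p c : ℝ} (hp : 0 < p) (hq : -1 < q)
    (hc : 0 < c) :
    IntegrableOn (fun t : ℝ => t ^ q * Real.exp (-c * t ^ p)) (Set.Ioi 0) := by
  refine not_imp_comm.1 integral_undef ?_
  rw [integral_rpow_mul_exp_neg_mul_rpow hp hq hc]
  have := Real.Gamma_pos_of_pos (show 0 < (q + 1) / p from div_pos (by linarith) hp)
  positivity

/-- Convergence of moments to those of a Weibull law, from convergence of the tails under a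
stretched exponential bound. -/
lemma tendsto_integral_pow_of_tail {Ω : Type*} [MeasurableSpace Ω] {P : Measure Ω}
    [IsProbabilityMeasure P] {T : ℕ → Ω → ℝ} {ρ q c C : ℝ} (hT : ∀ n, AEMeasurable (T n) P)
    (hT0 : ∀ᶠ n in atTop, 0 ≤ᵐ[P] T n) (hρ : 0 < ρ) (hq : 0 < q) (hc : 0 < c)
    (hbound : ∀ᶠ n in atTop, ∀ t, 0 < t → P.real {ω | t ≤ T n ω} ≤ C * Real.exp (-c * t ^ q))
    (hlim : ∀ t, 0 < t → Tendsto (fun n => P.real {ω | t ≤ T n ω}) atTop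
      (𝓝 (Real.exp (-t ^ ρ)))) {k : ℕ} (hk : 1 ≤ k) :
    Tendsto (fun n => ∫ ω, T n ω ^ k ∂P) atTop (𝓝 (Real.Gamma (1 + k / ρ))) := by
  have hk0 : (0 : ℝ) < k := by positivity
  have hkm : (-1 : ℝ) < k - 1 := by linarith
  have hanti : ∀ n, Antitone fun t => P.real {ω | t ≤ T n ω} := fun n s t hst =>
    measureReal_mono fun ω (hω : t ≤ T n ω) => hst.trans hω
  have hmeas : ∀ n, AEStronglyMeasurable
      (fun t : ℝ => t ^ ((k : ℝ) - 1) * P.real {ω | t ≤ T n ω}) (volume.restrict (Set.Ioi 0)) :=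
    fun n => (Measurable.mul (by fun_prop) (hanti n).measurable).aestronglyMeasurable
  have hdct : Tendsto (fun n => ∫ t in Set.Ioi 0, t ^ ((k : ℝ) - 1) * P.real {ω | t ≤ T n ω})
      atTop (𝓝 (∫ t in Set.Ioi 0, t ^ ((k : ℝ) - 1) * Real.exp (-t ^ ρ))) := by
    refine tendsto_integral_filter_of_dominated_convergence
      (fun t => C * (t ^ ((k : ℝ) - 1) * Real.exp (-c * t ^ q)))
      (Eventually.of_forall hmeas) ?_
      ((integrableOn_rpow_mul_exp_neg_mul_rpow' hq hkm hc).const_mul C) ?_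
    · filter_upwards [hbound] with n hn
      refine (ae_restrict_iff' measurableSet_Ioi).2 (Eventually.of_forall fun t ht => ?_)
      have ht0 : (0 : ℝ) < t := ht
      rw [Real.norm_of_nonneg (by positivity)]
      calc t ^ ((k : ℝ) - 1) * P.real {ω | t ≤ T n ω}
          ≤ t ^ ((k : ℝ) - 1) * (C * Real.exp (-c * t ^ q)) := by gcongr; exact hn t ht0
        _ = _ := by ring
    · refine (ae_restrict_iff' measurableSet_Ioi).2 (Eventually.of_forall fun t ht => ?_)
      exact (hlim t ht).const_mul _
  -- The integral equals `Γ(k/ρ) / ρ`; the layer-cake factor `k` completes `Γ(1 + k/ρ) = (k/ρ)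
  -- Γ(k/ρ)`.
  have hgamma : Real.Gamma (1 + k / ρ) =
      k * ∫ t in Set.Ioi 0, t ^ ((k : ℝ) - 1) * Real.exp (-t ^ ρ) := by
    rw [integral_rpow_mul_exp_neg_rpow hρ hkm, add_comm, Real.Gamma_add_one (by positivity),
      sub_add_cancel]
    ring
  rw [hgamma]
  refine (hdct.const_mul (k : ℝ)).congr' ?_
  filter_upwards [hT0] with n hn
  rw [integral_eq_lintegral_of_nonneg_ae
      (by filter_upwards [hn] with ω hω using pow_nonneg hω k)
      ((hT n).pow_const k).aestronglyMeasurable,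
    integral_eq_lintegral_of_nonneg_ae _ (hmeas n)]
  · have h1 := lintegral_rpow_eq_lintegral_meas_le_mul P hn (hT n) hk0
    simp only [Real.rpow_natCast] at h1
    rw [h1, ENNReal.toReal_mul, ENNReal.toReal_ofReal hk0.le]
    congr 2
    refine setLIntegral_congr_fun measurableSet_Ioi fun t ht => ?_
    have ht0 : (0 : ℝ) < t := ht
    rw [ENNReal.ofReal_mul (by positivity), ofReal_measureReal, mul_comm]
  · refine (ae_restrict_iff' measurableSet_Ioi).2 (Eventually.of_forall fun t ht => ?_)
    have ht0 : (0 : ℝ) < t := ht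
    simp only [Pi.zero_apply]
    positivity

/-! ### The conditional law, its tail and its quantiles. -/

variable {p : ℕ}

lemma measurableSet_fst_le (x : Fin p → ℝ) :
    MeasurableSet {q : (Fin p → ℝ) × ℝ | q.1 ≤ x} :=
  measurableSet_le measurable_fst measurable_const

section Law

variable {μ : Measure ((Fin p → ℝ) × ℝ)} {x : Fin p → ℝ}

lemma frontier_nonneg : 0 ≤ frontier μ x := Real.sSup_nonneg fun _ hy => hy.1

/-- The probability that an observation satisfies `X ≤ x` and `Y > φ(x) - ε`. -/
noncomputable def tail (μ : Measure ((Fin p → ℝ) × ℝ)) (x : Fin p → ℝ) (ε : ℝ) : ℝ :=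
  marginalCDF μ x * (1 - condDF μ x (frontier μ x - ε))

/-- The extreme value condition, as regular variation at `0` of the upper tail. -/
lemma tailCondition_iff (hFX : 0 < marginalCDF μ x) {ρ : ℝ} :
    TailCondition μ x ρ ↔
      ∀ z, 0 < z → Tendsto (fun ε => tail μ x (ε * z) / tail μ x ε) (𝓝[>] 0) (𝓝 (z ^ ρ)) := by
  have hratio : ∀ t z : ℝ,
      (1 - condDF μ x (frontier μ x - 1 / (t * z))) / (1 - condDF μ x (frontier μ x - 1 / t)) =
        tail μ x (t⁻¹ * z⁻¹) / tail μ x t⁻¹ := by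
    intro t z
    rw [tail, tail, mul_div_mul_left _ _ hFX.ne', one_div, one_div, mul_inv]
  unfold TailCondition RegVar
  constructor
  · intro h z hz
    have h1 := (h z⁻¹ (by positivity)).comp tendsto_inv_nhdsGT_zero
    rw [Real.inv_rpow hz.le, Real.rpow_neg hz.le, inv_inv] at h1
    refine h1.congr fun ε => ?_
    simp only [Function.comp]
    rw [hratio, inv_inv, inv_inv]
  · intro h z hz
    have h1 := (h z⁻¹ (by positivity)).comp tendsto_inv_atTop_nhdsGT_zero
    rw [Real.inv_rpow hz.le, ← Real.rpow_neg hz.le] at h1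
    refine h1.congr fun t => ?_
    simp only [Function.comp]
    rw [hratio]

/-- Otherwise `φ - ε`, nonnegative by `hεφ`, would already reach the quantile level, and the infimum
would give `norming μ x n ≥ ε`. -/
lemma one_lt_nat_mul_tail (hFX : 0 < marginalCDF μ x) {n : ℕ} (hn : 1 ≤ n) {ε : ℝ}
    (hε : norming μ x n < ε) (hεφ : ε < frontier μ x) : 1 < n * tail μ x ε := by
  have hn0 : (0 : ℝ) < n := by positivity
  by_contra! hle
  have h1 : 1 - 1 / (n * marginalCDF μ x) ≤ condDF μ x (frontier μ x - ε) := by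
    have : 1 - condDF μ x (frontier μ x - ε) ≤ 1 / (n * marginalCDF μ x) := by
      rw [le_div_iff₀ (by positivity)]
      rw [tail] at hle
      linarith
    linarith
  have h2 : condQuantile μ (1 - 1 / (n * marginalCDF μ x)) x ≤ frontier μ x - ε :=
    csInf_le ⟨0, fun _ hy => hy.1⟩ ⟨by linarith, h1⟩
  rw [norming] at hε
  linarith

variable [IsProbabilityMeasure μ]

/-- The conditional law of `Y` given `X ≤ x`. -/
noncomputable def condLaw (μ : Measure ((Fin p → ℝ) × ℝ)) (x : Fin p → ℝ) : Measure ℝ :=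
  (μ[|{q : (Fin p → ℝ) × ℝ | q.1 ≤ x}]).map Prod.snd

lemma isProbabilityMeasure_condLaw (hFX : 0 < marginalCDF μ x) :
    IsProbabilityMeasure (condLaw μ x) := by
  have hne : μ {q : (Fin p → ℝ) × ℝ | q.1 ≤ x} ≠ 0 := by
    intro h
    simp [marginalCDF, measureReal_def, h] at hFX
  have := cond_isProbabilityMeasure hne
  exact Measure.isProbabilityMeasure_map measurable_snd.aemeasurable

lemma condDF_eq_cdf (hFX : 0 < marginalCDF μ x) (y : ℝ) :
    condDF μ x y = cdf (condLaw μ x) y := by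
  have := isProbabilityMeasure_condLaw hFX
  rw [cdf_eq_real, condLaw, measureReal_def, Measure.map_apply measurable_snd measurableSet_Iic,
    cond_apply (measurableSet_fst_le x), ENNReal.toReal_mul, ENNReal.toReal_inv, condDF, jointCDF,
    marginalCDF, div_eq_inv_mul]
  rfl

lemma condDF_mono (hFX : 0 < marginalCDF μ x) : Monotone (condDF μ x) := by
  rw [funext (condDF_eq_cdf hFX)]
  exact monotone_cdf _

lemma condDF_nonneg (hFX : 0 < marginalCDF μ x) (y : ℝ) : 0 ≤ condDF μ x y := by
  rw [condDF_eq_cdf hFX]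
  exact cdf_nonneg _ _

lemma condDF_le_one (hFX : 0 < marginalCDF μ x) (y : ℝ) : condDF μ x y ≤ 1 := by
  rw [condDF_eq_cdf hFX]
  exact cdf_le_one _ _

/-- Right continuity, in the form needed to evaluate the distribution function at the frontier and
at a quantile. -/
lemma le_condDF_of_forall_gt (hFX : 0 < marginalCDF μ x) {α y : ℝ}
    (h : ∀ z, y < z → α ≤ condDF μ x z) : α ≤ condDF μ x y := by
  rw [funext (condDF_eq_cdf hFX)] at *
  have hcont := ((cdf (condLaw μ x)).right_continuous y).tendsto.mono_left
    (nhdsWithin_mono y Set.Ioi_subset_Ici_self)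
  refine ge_of_tendsto hcont ?_
  filter_upwards [self_mem_nhdsWithin] with z hz using h z hz

lemma condDF_of_neg (hμ : ∀ᵐ q ∂μ, 0 ≤ q.1 ∧ 0 ≤ q.2) {y : ℝ} (hy : y < 0) :
    condDF μ x y = 0 := by
  have : jointCDF μ x y = 0 := by
    rw [jointCDF, measureReal_eq_zero_iff, measure_eq_zero_iff_ae_notMem]
    filter_upwards [hμ] with q hq hq2
    linarith [hq.2, hq2.2]
  rw [condDF, this, zero_div]

lemma condDF_frontier (hFX : 0 < marginalCDF μ x)
    (hfin : BddAbove {y : ℝ | 0 ≤ y ∧ condDF μ x y < 1}) : condDF μ x (frontier μ x) = 1 := by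
  refine le_antisymm (condDF_le_one hFX _) (le_condDF_of_forall_gt hFX fun z hz => ?_)
  by_contra! hlt
  exact absurd (le_csSup hfin ⟨frontier_nonneg.trans hz.le, hlt⟩) (not_le.2 hz)

lemma condDF_lt_one (hμ : ∀ᵐ q ∂μ, 0 ≤ q.1 ∧ 0 ≤ q.2) (hFX : 0 < marginalCDF μ x) {y : ℝ}
    (hy : y < frontier μ x) : condDF μ x y < 1 := by
  rcases lt_or_ge y 0 with h0 | h0
  · rw [condDF_of_neg hμ h0]
    exact one_pos
  · have hne : {y : ℝ | 0 ≤ y ∧ condDF μ x y < 1}.Nonempty := by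
      by_contra hemp
      rw [Set.not_nonempty_iff_eq_empty] at hemp
      rw [frontier, hemp, Real.sSup_empty] at hy
      linarith
    obtain ⟨z, hz, hyz⟩ := exists_lt_of_lt_csSup hne hy
    exact lt_of_le_of_lt (condDF_mono hFX hyz.le) hz.2

lemma marginalCDF_le_one : marginalCDF μ x ≤ 1 := measureReal_le_one

lemma tail_mono (hFX : 0 < marginalCDF μ x) : Monotone (tail μ x) := by
  intro a b hab
  have := condDF_mono hFX (show frontier μ x - b ≤ frontier μ x - a by linarith)
  unfold tail
  gcongr

lemma tail_nonneg (hFX : 0 < marginalCDF μ x) (ε : ℝ) : 0 ≤ tail μ x ε :=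
  mul_nonneg hFX.le (sub_nonneg.2 (condDF_le_one hFX _))

lemma tail_le (hFX : 0 < marginalCDF μ x) (ε : ℝ) : tail μ x ε ≤ marginalCDF μ x :=
  mul_le_of_le_one_right hFX.le (by linarith [condDF_nonneg hFX (frontier μ x - ε)])

lemma tail_le_one (hFX : 0 < marginalCDF μ x) (ε : ℝ) : tail μ x ε ≤ 1 :=
  (tail_le hFX ε).trans marginalCDF_le_one

lemma tail_pos (hμ : ∀ᵐ q ∂μ, 0 ≤ q.1 ∧ 0 ≤ q.2) (hFX : 0 < marginalCDF μ x) (ε : ℝ)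
    (hε : 0 < ε) : 0 < tail μ x ε :=
  mul_pos hFX (sub_pos.2 (condDF_lt_one hμ hFX (by linarith)))

lemma tail_of_nonpos (hFX : 0 < marginalCDF μ x)
    (hfin : BddAbove {y : ℝ | 0 ≤ y ∧ condDF μ x y < 1}) {ε : ℝ} (hε : ε ≤ 0) :
    tail μ x ε = 0 := by
  have h1 := condDF_mono hFX (show frontier μ x ≤ frontier μ x - ε by linarith)
  rw [condDF_frontier hFX hfin] at h1
  rw [tail, le_antisymm (condDF_le_one hFX _) h1, sub_self, mul_zero]

lemma tail_of_frontier_lt (hμ : ∀ᵐ q ∂μ, 0 ≤ q.1 ∧ 0 ≤ q.2) {ε : ℝ} (hε : frontier μ x < ε) :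
    tail μ x ε = marginalCDF μ x := by
  rw [tail, condDF_of_neg hμ (by linarith), sub_zero, mul_one]

/-- Under the extreme value condition the frontier is positive. -/
lemma frontier_pos (hμ : ∀ᵐ q ∂μ, 0 ≤ q.1 ∧ 0 ≤ q.2) (hFX : 0 < marginalCDF μ x)
    (h0 : Tendsto (tail μ x) (𝓝[>] 0) (𝓝 0)) : 0 < frontier μ x := by
  refine lt_of_le_of_ne frontier_nonneg fun h => ?_
  have h1 : Tendsto (tail μ x) (𝓝[>] 0) (𝓝 (marginalCDF μ x)) := by
    refine tendsto_const_nhds.congr' ?_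
    filter_upwards [self_mem_nhdsWithin] with ε hε
    exact (tail_of_frontier_lt hμ (by rw [← h]; exact hε)).symm
  exact hFX.ne' (tendsto_nhds_unique h1 h0)

/-- Some `ε` in `(0, φ)` has tail below `1 / n`, so the quantile level is reached at `φ - ε`,
strictly before the frontier. -/
lemma norming_pos (hμ : ∀ᵐ q ∂μ, 0 ≤ q.1 ∧ 0 ≤ q.2) (hFX : 0 < marginalCDF μ x)
    (h0 : Tendsto (tail μ x) (𝓝[>] 0) (𝓝 0)) {n : ℕ} (hn : 1 ≤ n) : 0 < norming μ x n := by
  have hφ := frontier_pos hμ hFX h0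
  have hn0 : (0 : ℝ) < n := by positivity
  obtain ⟨ε, hε, hε0, hεφ⟩ := (((tendsto_order.1 h0).2 (1 / n) (by positivity)).and
    (Ioo_mem_nhdsGT hφ)).exists
  rw [norming, sub_pos]
  have h1 : 1 - condDF μ x (frontier μ x - ε) < 1 / (n * marginalCDF μ x) := by
    rw [tail, lt_div_iff₀ hn0] at hε
    rw [lt_div_iff₀ (by positivity)]
    linarith
  have h2 : condQuantile μ (1 - 1 / (n * marginalCDF μ x)) x ≤ frontier μ x - ε :=
    csInf_le ⟨0, fun _ hy => hy.1⟩ ⟨by linarith, by linarith⟩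
  linarith

/-- By right continuity the level `1 - 1/(n F_X)` is attained at the infimum that defines the
quantile. -/
lemma nat_mul_tail_norming_le (hFX : 0 < marginalCDF μ x)
    (hfin : BddAbove {y : ℝ | 0 ≤ y ∧ condDF μ x y < 1}) {n : ℕ} (hn : 1 ≤ n) :
    n * tail μ x (norming μ x n) ≤ 1 := by
  have hn0 : (0 : ℝ) < n := by positivity
  have h1 : 1 - 1 / (n * marginalCDF μ x) ≤
      condDF μ x (condQuantile μ (1 - 1 / (n * marginalCDF μ x)) x) := by
    refine le_condDF_of_forall_gt hFX fun z hz => ?_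
    have hne : {y | 0 ≤ y ∧ 1 - 1 / (n * marginalCDF μ x) ≤ condDF μ x y}.Nonempty := by
      refine ⟨frontier μ x, frontier_nonneg, ?_⟩
      rw [condDF_frontier hFX hfin]
      have : 0 < 1 / (n * marginalCDF μ x) := by positivity
      linarith
    obtain ⟨y, hy, hyz⟩ := exists_lt_of_csInf_lt hne hz
    exact hy.2.trans (condDF_mono hFX hyz.le)
  rw [tail, norming, sub_sub_cancel]
  calc n * (marginalCDF μ x * (1 - condDF μ x _)) = (n * marginalCDF μ x) * (1 - condDF μ x _) := by
        ring
    _ ≤ (n * marginalCDF μ x) * (1 / (n * marginalCDF μ x)) := by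
        gcongr
        linarith
    _ = 1 := mul_one_div_cancel (by positivity)

end Law

/-! ### The distribution of the estimator. -/

section Estimator

variable {Ω : Type*} {X : ℕ → Ω → Fin p → ℝ} {Y : ℕ → Ω → ℝ} {x : Fin p → ℝ} {n : ℕ}

/-- The second conjunct records the default value `0` when no observation qualifies; it disappears
for `y ≥ 0`. -/
lemma fdh_le_iff {ω : Ω} {y : ℝ} : fdh X Y x n ω ≤ y ↔
    (∀ i < n, X i ω ≤ x → Y i ω ≤ y) ∧ (0 ≤ y ∨ ∃ i < n, X i ω ≤ x) := by
  unfold fdh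
  split_ifs with h
  · rw [Finset.sup'_le_iff]
    obtain ⟨i, hi⟩ := h
    simp only [Finset.mem_filter, Finset.mem_range] at hi ⊢
    exact ⟨fun hle => ⟨fun i h1 h2 => hle i ⟨h1, h2⟩, Or.inr ⟨i, hi⟩⟩,
      fun hle i hi => hle.1 i hi.1 hi.2⟩
  · have h : ∀ i < n, ¬ X i ω ≤ x := fun i hi hx => h ⟨i, by simp [hi, hx]⟩
    constructor
    · exact fun hy => ⟨fun i hi hx => absurd hx (h i hi), Or.inl hy⟩
    · rintro ⟨-, hy | ⟨i, hi, hx⟩⟩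
      · exact hy
      · exact absurd hx (h i hi)

variable [MeasurableSpace Ω] {P : Measure Ω} {μ : Measure ((Fin p → ℝ) × ℝ)}

lemma measurable_fdh (hX : ∀ i, Measurable (X i)) (hY : ∀ i, Measurable (Y i)) :
    Measurable (fdh X Y x n) := by
  refine measurable_of_Iic fun y => ?_
  have : fdh X Y x n ⁻¹' Set.Iic y = {ω | (∀ i < n, X i ω ≤ x → Y i ω ≤ y) ∧
      (0 ≤ y ∨ ∃ i < n, X i ω ≤ x)} := by
    ext ω
    exact fdh_le_iff
  rw [this]
  refine measurableSet_setOfPred.2 (Measurable.and ?_ (measurable_const.or ?_))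
  · exact Measurable.forall fun i => measurable_const.imp (Measurable.imp
      (measurableSet_setOfPred.1 (measurableSet_le (hX i) measurable_const))
      (measurableSet_setOfPred.1 (measurableSet_le (hY i) measurable_const)))
  · exact Measurable.exists fun i => measurable_const.and
      (measurableSet_setOfPred.1 (measurableSet_le (hX i) measurable_const))

lemma aemeasurable_fdh (hXY : ∀ i, AEMeasurable (fun ω => (X i ω, Y i ω)) P) :
    AEMeasurable (fdh X Y x n) P := by
  refine ⟨fdh (fun i ω => ((hXY i).mk _ ω).1) (fun i ω => ((hXY i).mk _ ω).2) x n,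
    measurable_fdh (fun i => (hXY i).measurable_mk.fst) (fun i => (hXY i).measurable_mk.snd), ?_⟩
  filter_upwards [ae_all_iff.2 fun i => (hXY i).ae_eq_mk] with ω hω
  have h1 : ∀ i, ((hXY i).mk _ ω).1 = X i ω := fun i => by rw [← hω i]
  have h2 : ∀ i, ((hXY i).mk _ ω).2 = Y i ω := fun i => by rw [← hω i]
  exact eq_of_forall_ge_iff fun y => by simp only [fdh_le_iff, h1, h2]

lemma fdh_nonneg (hμ : ∀ᵐ q ∂μ, 0 ≤ q.1 ∧ 0 ≤ q.2)
    (hlaw : ∀ i, HasLaw (fun ω => (X i ω, Y i ω)) μ P) : ∀ᵐ ω ∂P, 0 ≤ fdh X Y x n ω := by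
  have h : ∀ i, ∀ᵐ ω ∂P, 0 ≤ Y i ω := by
    intro i
    rw [← (hlaw i).map_eq] at hμ
    filter_upwards [ae_of_ae_map (hlaw i).aemeasurable hμ] with ω hω using hω.2
  filter_upwards [ae_all_iff.2 h] with ω hω
  by_contra! hlt
  obtain ⟨h1, h2 | ⟨i, hi, hx⟩⟩ := fdh_le_iff.1 (le_refl (fdh X Y x n ω))
  · linarith
  · linarith [h1 i hi hx, hω i]

lemma measureReal_fdh_le_of_neg (hμ : ∀ᵐ q ∂μ, 0 ≤ q.1 ∧ 0 ≤ q.2)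
    (hlaw : ∀ i, HasLaw (fun ω => (X i ω, Y i ω)) μ P) {y : ℝ} (hy : y < 0) :
    P.real {ω | fdh X Y x n ω ≤ y} = 0 := by
  rw [measureReal_def, measure_eq_zero_iff_ae_notMem.2, ENNReal.toReal_zero]
  filter_upwards [fdh_nonneg hμ hlaw] with ω hω h
  exact absurd (le_trans hω h) (not_le.2 hy)

variable [IsProbabilityMeasure μ]

/-- The distribution function of the estimator on the nonnegative half-line. -/
lemma measureReal_fdh_le (hFX : 0 < marginalCDF μ x)
    (hlaw : ∀ i, HasLaw (fun ω => (X i ω, Y i ω)) μ P)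
    (hindep : iIndepFun (fun i ω => (X i ω, Y i ω)) P) {y : ℝ} (hy : 0 ≤ y) :
    P.real {ω | fdh X Y x n ω ≤ y} =
      (1 - marginalCDF μ x * (1 - condDF μ x y)) ^ n := by
  set A : Set ((Fin p → ℝ) × ℝ) := {q | q.1 ≤ x ∧ y < q.2} with hA
  have hyset : MeasurableSet {q : (Fin p → ℝ) × ℝ | q.2 ≤ y} :=
    measurableSet_le measurable_snd measurable_const
  have hAm : MeasurableSet A :=
    (measurableSet_fst_le x).inter (measurableSet_lt measurable_const measurable_snd)
  have hset : {ω | fdh X Y x n ω ≤ y} =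
      ⋂ i ∈ Finset.range n, (fun ω => (X i ω, Y i ω)) ⁻¹' Aᶜ := by
    ext ω
    simp only [Set.mem_ofPred_eq, fdh_le_iff, hy, true_or, and_true, Set.mem_iInter,
      Finset.mem_range, Set.mem_preimage, Set.mem_compl_iff, hA, not_and, not_lt]
  have hμA : μ.real A = marginalCDF μ x * (1 - condDF μ x y) := by
    have h1 : A = {q | q.1 ≤ x} \ {q | q.1 ≤ x ∧ q.2 ≤ y} := by
      ext q
      simp only [hA, Set.mem_ofPred_eq, Set.mem_sdiff, not_and, not_le]
      tauto
    have h2 : MeasurableSet {q : (Fin p → ℝ) × ℝ | q.1 ≤ x ∧ q.2 ≤ y} :=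
      (measurableSet_fst_le x).inter hyset
    have h3 : {q : (Fin p → ℝ) × ℝ | q.1 ≤ x ∧ q.2 ≤ y} ⊆ {q | q.1 ≤ x} := fun q hq => hq.1
    rw [h1, measureReal_sdiff h3 h2, condDF, mul_sub, mul_one, mul_div_cancel₀ _ hFX.ne']
    rfl
  rw [hset, measureReal_def, hindep.measure_inter_preimage_eq_mul _ fun i _ => hAm.compl,
    ENNReal.toReal_prod, ← hμA, ← probReal_compl_eq_one_sub hAm]
  have : ∀ i, (P ((fun ω => (X i ω, Y i ω)) ⁻¹' Aᶜ)).toReal = μ.real Aᶜ := by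
    intro i
    rw [measureReal_def, ← (hlaw i).map_eq,
      Measure.map_apply_of_aemeasurable (hlaw i).aemeasurable hAm.compl]
  simp only [this, Finset.prod_const, Finset.card_range]

/-- Below the frontier, the distribution function of the estimator is uniformly close to the
power of a one-observation distribution function. -/
lemma abs_measureReal_fdh_le_sub (hμ : ∀ᵐ q ∂μ, 0 ≤ q.1 ∧ 0 ≤ q.2) (hFX : 0 < marginalCDF μ x)
    (hlaw : ∀ i, HasLaw (fun ω => (X i ω, Y i ω)) μ P)
    (hindep : iIndepFun (fun i ω => (X i ω, Y i ω)) P) (ε : ℝ) :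
    |P.real {ω | fdh X Y x n ω ≤ frontier μ x - ε} - (1 - tail μ x ε) ^ n| ≤
      (1 - marginalCDF μ x) ^ n := by
  have hm : 0 ≤ 1 - marginalCDF μ x := sub_nonneg.2 marginalCDF_le_one
  rcases lt_or_ge (frontier μ x - ε) 0 with h | h
  -- At negative levels the probability is `0` while the tail has saturated at `F_X(x)`, so the
  -- error is exactly the stated bound.
  · rw [measureReal_fdh_le_of_neg hμ hlaw h, tail_of_frontier_lt hμ (by linarith), zero_sub,
      abs_neg, abs_of_nonneg (pow_nonneg hm n)]
  · rw [measureReal_fdh_le hFX hlaw hindep h, ← tail, sub_self, abs_zero]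
    exact pow_nonneg hm n

variable [IsProbabilityMeasure P]

/-- At `y = φ(x)` the one-observation exceedance probability is `0`, so the formula for the
distribution function gives `1`. -/
lemma fdh_le_frontier (hFX : 0 < marginalCDF μ x)
    (hfin : BddAbove {y : ℝ | 0 ≤ y ∧ condDF μ x y < 1})
    (hlaw : ∀ i, HasLaw (fun ω => (X i ω, Y i ω)) μ P)
    (hindep : iIndepFun (fun i ω => (X i ω, Y i ω)) P) :
    ∀ᵐ ω ∂P, fdh X Y x n ω ≤ frontier μ x := by
  have h1 := measureReal_fdh_le (n := n) hFX hlaw hindep (frontier_nonneg (μ := μ) (x := x))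
  rw [condDF_frontier hFX hfin, sub_self, mul_zero, sub_zero, one_pow] at h1
  have hnull : NullMeasurableSet {ω | fdh X Y x n ω ≤ frontier μ x} P :=
    nullMeasurableSet_le (aemeasurable_fdh fun i => (hlaw i).aemeasurable) aemeasurable_const
  refine (mem_ae_iff_prob_eq_one₀ hnull).2 ?_
  rwa [measureReal_def, ENNReal.toReal_eq_one_iff] at h1

end Estimator

/-! ### Reversed Weibull laws and properties of limit laws. -/

section RevWeibull

variable {ρ : ℝ}

lemma revWeibull_eq_exp (hρ : 0 < ρ) (y : ℝ) :
    revWeibull ρ y = Real.exp (-(max (-y) 0) ^ ρ) := by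
  unfold revWeibull
  split_ifs with h
  · rw [max_eq_left (by linarith)]
  · rw [max_eq_right (by linarith), Real.zero_rpow hρ.ne', neg_zero, Real.exp_zero]

lemma revWeibull_neg {w : ℝ} (hw : 0 < w) : revWeibull ρ (-w) = Real.exp (-w ^ ρ) := by
  rw [revWeibull, if_pos (by linarith), neg_neg]

lemma revWeibull_of_nonneg (hρ : 0 < ρ) {y : ℝ} (hy : 0 ≤ y) : revWeibull ρ y = 1 := by
  rw [revWeibull_eq_exp hρ, max_eq_right (by linarith), Real.zero_rpow hρ.ne', neg_zero,
    Real.exp_zero]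

lemma continuous_revWeibull (hρ : 0 < ρ) : Continuous (revWeibull ρ) := by
  rw [funext (revWeibull_eq_exp hρ)]
  exact Real.continuous_exp.comp
    ((continuous_neg.max continuous_const).rpow_const fun _ => Or.inr hρ.le).neg

lemma monotone_revWeibull (hρ : 0 < ρ) : Monotone (revWeibull ρ) := by
  intro a b hab
  rw [revWeibull_eq_exp hρ, revWeibull_eq_exp hρ]
  gcongr

lemma tendsto_revWeibull_atBot (hρ : 0 < ρ) : Tendsto (revWeibull ρ) atBot (𝓝 0) := by
  rw [funext (revWeibull_eq_exp hρ)]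
  refine Real.tendsto_exp_atBot.comp (tendsto_neg_atTop_atBot.comp
    ((tendsto_rpow_atTop hρ).comp ?_))
  exact tendsto_atTop_mono (fun y => le_max_left _ _) tendsto_neg_atBot_atTop

lemma tendsto_revWeibull_atTop (hρ : 0 < ρ) : Tendsto (revWeibull ρ) atTop (𝓝 1) := by
  refine tendsto_const_nhds.congr' ?_
  filter_upwards [eventually_ge_atTop 0] with y hy using (revWeibull_of_nonneg hρ hy).symm

lemma nondegenerate_revWeibull : Nondegenerate (revWeibull ρ) := by
  rintro ⟨c, hc⟩
  have h := hc (-1)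
  rw [revWeibull_neg one_pos, Real.one_rpow] at h
  split_ifs at h
  · rw [Real.exp_eq_one_iff] at h
    norm_num at h
  · exact absurd h (Real.exp_pos _).ne'

end RevWeibull

section Limits

variable {Ω : Type*} [MeasurableSpace Ω] {P : Measure Ω} [IsProbabilityMeasure P]
  {U : ℕ → Ω → ℝ} {G : ℝ → ℝ}

/-- A distribution function which is not that of a constant takes a value in `(0, 1)`. -/
lemma Nondegenerate.exists_mem_Ioo (hG : Nondegenerate G) (h : ConvergesInLaw P U G) :
    ∃ y, 0 < G y ∧ G y < 1 := by
  have hmono := h.monotone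
  have h0 : ∀ y, 0 ≤ G y := hmono.le_of_tendsto h.tendsto_atBot
  have h1 : ∀ y, G y ≤ 1 := hmono.ge_of_tendsto h.tendsto_atTop
  by_contra! hcon
  have hval : ∀ y, 0 < G y → G y = 1 := fun y hy => le_antisymm (h1 y) (hcon y hy)
  obtain ⟨y₁, hy₁⟩ := ((tendsto_order.1 h.tendsto_atTop).1 0 one_pos).exists
  obtain ⟨y₀, hy₀⟩ := ((tendsto_order.1 h.tendsto_atBot).2 1 one_pos).exists
  have hne : {y | G y = 1}.Nonempty := ⟨y₁, hval _ hy₁⟩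
  have hbdd : BddBelow {y | G y = 1} := ⟨y₀, fun y hy => by
    by_contra! hlt
    have := hmono hlt.le
    rw [Set.mem_ofPred_eq] at hy
    linarith⟩
  have hgt : ∀ y, sInf {y | G y = 1} < y → G y = 1 := by
    intro y hy
    obtain ⟨z, hz, hzy⟩ := exists_lt_of_csInf_lt hne hy
    exact le_antisymm (h1 y) (hz.symm.le.trans (hmono hzy.le))
  refine hG ⟨sInf {y | G y = 1}, fun y => ?_⟩
  split_ifs with hy
  · rcases hy.eq_or_lt with rfl | hy
    · have hcont := (h.continuousWithinAt_Ici (sInf {y | G y = 1})).tendsto.mono_left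
        (nhdsWithin_mono _ Set.Ioi_subset_Ici_self)
      refine tendsto_nhds_unique hcont (tendsto_const_nhds.congr' ?_)
      filter_upwards [self_mem_nhdsWithin] with z hz using (hgt z hz).symm
    · exact hgt y hy
  · by_contra hne0
    exact hy (csInf_le hbdd (hval y (lt_of_le_of_ne (h0 y) (Ne.symm hne0))))

/-- Continuity points of a monotone function are dense, and right continuity keeps `G` below `c`
just after `y`. After reflection this is the hypothesis `hleft` of `exists_scale_rpow_eq`. -/
lemma ConvergesInLaw.exists_continuousAt_mem_Ioo (h : ConvergesInLaw P U G) {y z c : ℝ}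
    (hyz : y < z) (hc : G y < c) : ∃ u, ContinuousAt G u ∧ y < u ∧ u < z ∧ G u < c := by
  have h1 : ∀ᶠ u in 𝓝[>] y, G u < c :=
    (tendsto_order.1 ((h.continuousWithinAt_Ici y).tendsto.mono_left
      (nhdsWithin_mono _ Set.Ioi_subset_Ici_self))).2 c hc
  obtain ⟨t, ht, hsub⟩ := mem_nhdsGT_iff_exists_Ioo_subset.1 h1
  have hdense : Dense {u | ContinuousAt G u} := by
    have := h.monotone.countable_not_continuousAt.dense_compl ℝ
    refine this.mono fun u hu => ?_
    simpa using hu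
  obtain ⟨u, hu, hu1, hu2⟩ := hdense.exists_between (lt_min hyz ht)
  exact ⟨u, hu, hu1, hu2.trans_le (min_le_left _ _), hsub ⟨hu1, hu2.trans_le (min_le_right _ _)⟩⟩

/-- Allows the threshold to move with `n`, as it does when the estimator is standardized by its own
mean and variance. -/
lemma ConvergesInLaw.tendsto_of_tendsto (h : ConvergesInLaw P U G) (hG : Continuous G)
    {y : ℕ → ℝ} {a : ℝ} (hy : Tendsto y atTop (𝓝 a)) :
    Tendsto (fun n => P.real {ω | U n ω ≤ y n}) atTop (𝓝 (G a)) := by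
  rw [tendsto_order]
  constructor
  · intro c hc
    have h1 : ∀ᶠ z in 𝓝[<] a, c < G z :=
      nhdsWithin_le_nhds ((tendsto_order.1 (hG.tendsto a)).1 c hc)
    obtain ⟨z, hz, hza⟩ := (h1.and self_mem_nhdsWithin).exists
    filter_upwards [(tendsto_order.1 (h.tendsto hG.continuousAt)).1 c hz,
      (tendsto_order.1 hy).1 z hza] with n h2 h3
    exact lt_of_lt_of_le h2 (measureReal_mono fun ω (hω : U n ω ≤ z) => hω.trans h3.le)
  · intro c hc
    have h1 : ∀ᶠ z in 𝓝[>] a, G z < c :=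
      nhdsWithin_le_nhds ((tendsto_order.1 (hG.tendsto a)).2 c hc)
    obtain ⟨z, hz, hza⟩ := (h1.and self_mem_nhdsWithin).exists
    filter_upwards [(tendsto_order.1 (h.tendsto hG.continuousAt)).2 c hz,
      (tendsto_order.1 hy).2 z hza] with n h2 h3
    exact lt_of_le_of_lt (measureReal_mono fun ω (hω : U n ω ≤ y n) => hω.trans h3.le) h2

end Limits

/-! ### Limit theorems for the estimator. -/

/-- The sampling assumptions: the `(X i, Y i)` are independent with law `μ` on the nonnegative
orthant, `x` has positive marginal distribution function and finite frontier. -/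
structure IsSample {p : ℕ} {Ω : Type*} [MeasurableSpace Ω] (P : Measure Ω)
    (μ : Measure ((Fin p → ℝ) × ℝ)) (X : ℕ → Ω → Fin p → ℝ) (Y : ℕ → Ω → ℝ)
    (x : Fin p → ℝ) : Prop where
  nonneg : ∀ᵐ q ∂μ, 0 ≤ q.1 ∧ 0 ≤ q.2
  law : ∀ i, HasLaw (fun ω => (X i ω, Y i ω)) μ P
  indep : iIndepFun (fun i ω => (X i ω, Y i ω)) P
  pos : 0 < marginalCDF μ x
  bdd : BddAbove {y : ℝ | 0 ≤ y ∧ condDF μ x y < 1}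

namespace IsSample

variable {p : ℕ} {Ω : Type*} [MeasurableSpace Ω] {P : Measure Ω}
  {μ : Measure ((Fin p → ℝ) × ℝ)} {X : ℕ → Ω → Fin p → ℝ}
  {Y : ℕ → Ω → ℝ} {x : Fin p → ℝ} {b : ℕ → ℝ} {ρ : ℝ}

lemma aemeasurable (h : IsSample P μ X Y x) (n : ℕ) : AEMeasurable (fdh X Y x n) P :=
  aemeasurable_fdh fun i => (h.law i).aemeasurable

section Limit

variable [IsProbabilityMeasure μ]

/-- The maximum of the `n` observations has distribution function close to
`(1 - tail) ^ n`, at any scale. -/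
lemma tendsto_cdf_iff (h : IsSample P μ X Y x) (hb : ∀ n, 1 ≤ n → 0 < b n) {w L : ℝ} :
    Tendsto (fun n => P.real {ω | (b n)⁻¹ * (fdh X Y x n ω - frontier μ x) ≤ -w}) atTop (𝓝 L) ↔
      Tendsto (fun n => (1 - tail μ x (b n * w)) ^ n) atTop (𝓝 L) := by
  have hdiff : Tendsto (fun n => P.real {ω | (b n)⁻¹ * (fdh X Y x n ω - frontier μ x) ≤ -w} -
      (1 - tail μ x (b n * w)) ^ n) atTop (𝓝 0) := by
    have hm : Tendsto (fun n => (1 - marginalCDF μ x) ^ n) atTop (𝓝 0) :=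
      tendsto_pow_atTop_nhds_zero_of_lt_one (sub_nonneg.2 marginalCDF_le_one)
        (by linarith [h.pos])
    refine squeeze_zero_norm' ?_ hm
    filter_upwards [eventually_ge_atTop 1] with n hn
    have hset : {ω | (b n)⁻¹ * (fdh X Y x n ω - frontier μ x) ≤ -w} =
        {ω | fdh X Y x n ω ≤ frontier μ x - b n * w} := by
      ext ω
      simp only [Set.mem_ofPred_eq]
      rw [inv_mul_le_iff₀ (hb n hn)]
      constructor <;> intro h <;> linarith
    rw [hset, Real.norm_eq_abs]
    exact abs_measureReal_fdh_le_sub h.nonneg h.pos h.law h.indep _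
  constructor
  · intro h1
    simpa using h1.sub hdiff
  · intro h1
    simpa using h1.add hdiff

variable [IsProbabilityMeasure P]

/-- For `w > 0`, `(1 - V)^n → exp(-w^ρ)` amounts to `n V → w^ρ`; for `w ≤ 0` the tail vanishes and
both distribution functions equal `1` in the limit. -/
lemma convergesInLaw_revWeibull_iff (h : IsSample P μ X Y x) (hb : ∀ n, 1 ≤ n → 0 < b n)
    (hρ : 0 < ρ) :
    ConvergesInLaw P (fun n ω => (b n)⁻¹ * (fdh X Y x n ω - frontier μ x)) (revWeibull ρ) ↔
      ∀ w, 0 < w → Tendsto (fun n : ℕ => n * tail μ x (b n * w)) atTop (𝓝 (w ^ ρ)) := by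
  constructor
  · intro hconv w hw
    refine tendsto_nat_mul_of_tendsto_one_sub_pow (fun n => tail_nonneg h.pos _)
      (fun n => tail_le_one h.pos _) ?_
    rw [← revWeibull_neg hw]
    exact (h.tendsto_cdf_iff hb).1 (hconv.tendsto (continuous_revWeibull hρ).continuousAt)
  · intro hlim
    refine convergesInLaw_of_tendsto (fun n => ((h.aemeasurable n).sub_const _).const_mul _)
      (monotone_revWeibull hρ) (continuous_revWeibull hρ) (tendsto_revWeibull_atBot hρ)
      (tendsto_revWeibull_atTop hρ) fun y => ?_
    obtain ⟨w, rfl⟩ : ∃ w, y = -w := ⟨-y, (neg_neg y).symm⟩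
    rw [h.tendsto_cdf_iff hb]
    rcases lt_or_ge 0 w with hw | hw
    · rw [revWeibull_neg hw]
      exact tendsto_one_sub_pow_exp (hlim w hw)
    · rw [revWeibull_of_nonneg hρ (by linarith)]
      refine tendsto_const_nhds.congr' ?_
      filter_upwards [eventually_ge_atTop 1] with n hn
      rw [tail_of_nonpos h.pos h.bdd (mul_nonpos_of_nonneg_of_nonpos (hb n hn).le hw), sub_zero,
        one_pow]

lemma tailCondition_of_convergesInLaw (h : IsSample P μ X Y x) (hb : ∀ n, 1 ≤ n → 0 < b n)
    (hρ : 0 < ρ) (hconv : ConvergesInLaw P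
      (fun n ω => (b n)⁻¹ * (fdh X Y x n ω - frontier μ x)) (revWeibull ρ)) :
    TailCondition μ x ρ :=
  (tailCondition_iff h.pos).2 fun _ hz => tendsto_div_of_tendsto_nat_mul (tail_mono h.pos)
    (tail_pos h.nonneg h.pos) hb ((h.convergesInLaw_revWeibull_iff hb hρ).1 hconv) hρ hz

/-- Every non-degenerate limit law is a reversed Weibull law, up to scale. -/
lemma exists_eq_revWeibull (h : IsSample P μ X Y x) (hb : ∀ n, 1 ≤ n → 0 < b n) {G : ℝ → ℝ}
    (hG : Nondegenerate G)
    (hconv : ConvergesInLaw P (fun n ω => (b n)⁻¹ * (fdh X Y x n ω - frontier μ x)) G) :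
    ∃ ρ : ℝ, 0 < ρ ∧ ∃ c : ℝ, 0 < c ∧ (∀ y, G y = revWeibull ρ (y / c)) ∧
      ConvergesInLaw P
        (fun n ω => (c * b n)⁻¹ * (fdh X Y x n ω - frontier μ x)) (revWeibull ρ) := by
  have hmono := hconv.monotone
  have hG0 : ∀ y, 0 ≤ G y := hmono.le_of_tendsto hconv.tendsto_atBot
  have hG1 : ∀ y, G y ≤ 1 := hmono.ge_of_tendsto hconv.tendsto_atTop
  have hlim : ∀ w, ContinuousAt G (-w) →
      Tendsto (fun n => (1 - tail μ x (b n * w)) ^ n) atTop (𝓝 (G (-w))) :=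
    fun w hw => (h.tendsto_cdf_iff hb).1 (hconv.tendsto hw)
  -- No mass lies beyond the frontier, so the limit is `1` at continuity points to the right of `y`;
  -- a value below `1` at `y` would persist at one of them.
  have hGnonneg : ∀ y, 0 ≤ y → G y = 1 := by
    intro y hy
    refine le_antisymm (hG1 y) ?_
    by_contra! hlt
    obtain ⟨u, hu, hyu, -, hGu⟩ := hconv.exists_continuousAt_mem_Ioo (lt_add_one y) hlt
    have h1 := hlim (-u) (by rwa [neg_neg])
    rw [neg_neg] at h1
    refine hGu.ne (tendsto_nhds_unique h1 (tendsto_const_nhds.congr' ?_))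
    filter_upwards [eventually_ge_atTop 1] with n hn
    rw [tail_of_nonpos h.pos h.bdd
      (mul_nonpos_of_nonneg_of_nonpos (hb n hn).le (by linarith)), sub_zero, one_pow]
  set g : ℝ → ℝ := fun w => G (-w) with hg
  have hanti : Antitone g := fun a b hab => hmono (neg_le_neg hab)
  have hleft : ∀ a w c, 0 ≤ a → a < w → g w < c →
      ∃ u ∈ {u | ContinuousAt G (-u)}, a < u ∧ u < w ∧ g u < c := by
    intro a w c _ haw hc
    obtain ⟨u, hu, h1, h2, h3⟩ := hconv.exists_continuousAt_mem_Ioo (neg_lt_neg haw) hc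
    refine ⟨-u, ?_, by linarith, by linarith, ?_⟩
    · rwa [Set.mem_ofPred_eq, neg_neg]
    · simpa only [hg, neg_neg] using h3
  have htop : Tendsto g atTop (𝓝 0) := hconv.tendsto_atBot.comp tendsto_neg_atTop_atBot
  obtain ⟨y, hy0, hy1⟩ := hG.exists_mem_Ioo hconv
  have hyneg : y < 0 := by
    by_contra! hle
    exact hy1.ne (hGnonneg y hle)
  obtain ⟨w₀, hw₀D, hw₀, hw₀y, hgw₀⟩ := hleft 0 (-y) 1 le_rfl (by linarith)
    (by simpa only [hg, neg_neg] using hy1)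
  have hgw₀' : 0 < g w₀ := hy0.trans_le (hmono (by linarith))
  obtain ⟨ρ, hρ, c, hc, hgc⟩ := eq_exp_neg_rpow_of_rpow_eq (hanti.antitoneOn _)
    (fun w _ => hG1 _) hw₀ hgw₀' hgw₀ fun s hs =>
      exists_scale_rpow_eq (tail_mono h.pos) (tail_le_one h.pos) hb (hanti.antitoneOn _)
        (fun w _ => hG0 _) hleft htop (fun w hw _ => hlim w hw) hw₀ hw₀D hgw₀' hs
  have hGeq : ∀ y, G y = revWeibull ρ (y / c) := by
    intro y
    rcases lt_or_ge y 0 with hy | hy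
    · have h1 := hgc (-y) (by linarith)
      rw [hg] at h1
      simp only [neg_neg] at h1
      rw [h1, ← revWeibull_neg (div_pos (by linarith) hc), neg_div, neg_neg]
    · rw [hGnonneg y hy, revWeibull_of_nonneg hρ (by positivity)]
  refine ⟨ρ, hρ, c, hc, hGeq, ?_⟩
  rw [h.convergesInLaw_revWeibull_iff (fun n hn => mul_pos hc (hb n hn)) hρ]
  intro w hw
  refine tendsto_nat_mul_of_tendsto_one_sub_pow (fun n => tail_nonneg h.pos _)
    (fun n => tail_le_one h.pos _) ?_
  have hcont : Continuous G := by
    rw [funext hGeq]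
    exact (continuous_revWeibull hρ).comp (continuous_id.div_const c)
  have h1 := hlim (c * w) hcont.continuousAt
  have h2 := hgc (c * w) (by positivity)
  rw [mul_div_cancel_left₀ _ hc.ne'] at h2
  rw [← h2]
  refine h1.congr fun n => ?_
  rw [mul_comm c (b n), mul_assoc]

end Limit

section Norming

variable [IsProbabilityMeasure μ]

lemma tendsto_tail (h : IsSample P μ X Y x) (hρ : 0 < ρ) (htail : TailCondition μ x ρ) :
    Tendsto (tail μ x) (𝓝[>] 0) (𝓝 0) :=
  tendsto_zero_of_tendsto_div (tail_mono h.pos) (tail_pos h.nonneg h.pos) hρ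
    ((tailCondition_iff h.pos).1 htail)

lemma frontier_pos (h : IsSample P μ X Y x) (hρ : 0 < ρ) (htail : TailCondition μ x ρ) :
    0 < frontier μ x :=
  FDH.frontier_pos h.nonneg h.pos (h.tendsto_tail hρ htail)

lemma norming_pos (h : IsSample P μ X Y x) (hρ : 0 < ρ) (htail : TailCondition μ x ρ) (n : ℕ)
    (hn : 1 ≤ n) : 0 < norming μ x n :=
  FDH.norming_pos h.nonneg h.pos (h.tendsto_tail hρ htail) hn

lemma tendsto_norming (h : IsSample P μ X Y x) (hρ : 0 < ρ) (htail : TailCondition μ x ρ) :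
    Tendsto (norming μ x) atTop (𝓝[>] 0) :=
  tendsto_nhdsGT_zero_of_nat_mul_le (tail_mono h.pos) (tail_pos h.nonneg h.pos)
    (h.norming_pos hρ htail) fun _ hn => nat_mul_tail_norming_le h.pos h.bdd hn

lemma tendsto_nat_mul_tail_norming (h : IsSample P μ X Y x) (hρ : 0 < ρ)
    (htail : TailCondition μ x ρ) :
    Tendsto (fun n : ℕ => n * tail μ x (norming μ x n)) atTop (𝓝 1) :=
  tendsto_nat_mul_norming (tail_pos h.nonneg h.pos) hρ (h.frontier_pos hρ htail)
    ((tailCondition_iff h.pos).1 htail) (h.tendsto_norming hρ htail)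
    (fun _ hn => nat_mul_tail_norming_le h.pos h.bdd hn)
    fun _ hn _ => one_lt_nat_mul_tail h.pos hn

variable [IsProbabilityMeasure P]

/-- Convergence to the reversed Weibull law with the quantile norming constants. -/
lemma convergesInLaw_norming (h : IsSample P μ X Y x) (hρ : 0 < ρ)
    (htail : TailCondition μ x ρ) :
    ConvergesInLaw P (fun n ω => (norming μ x n)⁻¹ * (fdh X Y x n ω - frontier μ x))
      (revWeibull ρ) :=
  (h.convergesInLaw_revWeibull_iff (h.norming_pos hρ htail) hρ).2 fun _ hw =>
    tendsto_nat_mul_rpow (tail_pos h.nonneg h.pos) ((tailCondition_iff h.pos).1 htail)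
      (h.tendsto_norming hρ htail) (h.tendsto_nat_mul_tail_norming hρ htail) hw

lemma ae_mem_Icc (h : IsSample P μ X Y x) (n : ℕ) :
    ∀ᵐ ω ∂P, fdh X Y x n ω ∈ Set.Icc 0 (frontier μ x) := by
  filter_upwards [fdh_nonneg h.nonneg h.law, fdh_le_frontier h.pos h.bdd h.law h.indep]
    with ω h1 h2 using ⟨h1, h2⟩

lemma memLp (h : IsSample P μ X Y x) (n : ℕ) : MemLp (fdh X Y x n) 2 P := by
  refine MemLp.of_bound (h.aemeasurable n).aestronglyMeasurable (frontier μ x) ?_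
  filter_upwards [h.ae_mem_Icc n] with ω hω
  rw [Real.norm_of_nonneg hω.1]
  exact hω.2

lemma integrable_pow (h : IsSample P μ X Y x) (n : ℕ) (a : ℝ) (k : ℕ) :
    Integrable (fun ω => (a * (frontier μ x - fdh X Y x n ω)) ^ k) P := by
  refine Integrable.of_bound
    ((((h.aemeasurable n).const_sub _).const_mul a).pow_const k).aestronglyMeasurable
    ((|a| * frontier μ x) ^ k) ?_
  filter_upwards [h.ae_mem_Icc n] with ω hω
  rw [norm_pow, norm_mul, Real.norm_eq_abs, Real.norm_of_nonneg (sub_nonneg.2 hω.2)]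
  gcongr
  · exact mul_nonneg (abs_nonneg a) (sub_nonneg.2 hω.2)
  · linarith [hω.1]

/-- Convergence of the moments of the normalized estimator. -/
lemma tendsto_moment (h : IsSample P μ X Y x) (hρ : 0 < ρ) (htail : TailCondition μ x ρ)
    {k : ℕ} (hk : 1 ≤ k) :
    Tendsto (fun n : ℕ => ∫ ω, ((norming μ x n)⁻¹ * (frontier μ x - fdh X Y x n ω)) ^ k ∂P)
      atTop (𝓝 (Real.Gamma (1 + k / ρ))) := by
  have hbpos := h.norming_pos hρ htail
  obtain ⟨c, hc, hpotter⟩ := exists_potter_bound (tail_mono h.pos) (tail_pos h.nonneg h.pos) hρ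
    (h.frontier_pos hρ htail) ((tailCondition_iff h.pos).1 htail) (h.tendsto_norming hρ htail)
    (h.tendsto_nat_mul_tail_norming hρ htail)
  -- The constant `C = exp c` makes the bound trivial for `t < 1`. For `t ≥ 1` the Potter bound
  -- applies until `norming μ x n * t` exceeds the frontier, where the probability is `0`.
  refine tendsto_integral_pow_of_tail (q := ρ / 2) (c := c) (C := Real.exp c)
    (fun n => ((h.aemeasurable n).const_sub _).const_mul _) ?_ hρ (by positivity) hc ?_ ?_ hk
  · filter_upwards [eventually_ge_atTop 1] with n hn
    filter_upwards [h.ae_mem_Icc n] with ω hω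
    exact mul_nonneg (inv_nonneg.2 (hbpos n hn).le) (sub_nonneg.2 hω.2)
  · filter_upwards [hpotter, eventually_ge_atTop 1] with n hn hn1 t ht
    have hb := hbpos n hn1
    rw [← Real.exp_add]
    rcases lt_or_ge t 1 with ht1 | ht1
    · refine measureReal_le_one.trans (Real.one_le_exp ?_)
      have : t ^ (ρ / 2) ≤ 1 := Real.rpow_le_one ht.le ht1.le (by positivity)
      nlinarith
    · have hset : {ω | t ≤ (norming μ x n)⁻¹ * (frontier μ x - fdh X Y x n ω)} =
          {ω | fdh X Y x n ω ≤ frontier μ x - norming μ x n * t} := by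
        ext ω
        simp only [Set.mem_ofPred_eq]
        rw [le_inv_mul_iff₀ hb]
        constructor <;> intro h <;> linarith
      rw [hset]
      rcases lt_or_ge (frontier μ x - norming μ x n * t) 0 with hlt | hge
      · rw [measureReal_fdh_le_of_neg h.nonneg h.law hlt]
        positivity
      · rw [measureReal_fdh_le h.pos h.law h.indep hge, ← tail]
        have h1 := hn t ht1 (by linarith)
        have h2 : 0 ≤ 1 - tail μ x (norming μ x n * t) := sub_nonneg.2 (tail_le_one h.pos _)
        calc (1 - tail μ x (norming μ x n * t)) ^ n
            ≤ Real.exp (-tail μ x (norming μ x n * t)) ^ n :=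
              pow_le_pow_left₀ h2 (Real.one_sub_le_exp_neg _) n
          _ = Real.exp (n * -tail μ x (norming μ x n * t)) := (Real.exp_nat_mul _ _).symm
          _ ≤ Real.exp (c + -c * t ^ (ρ / 2)) := Real.exp_le_exp.2 (by linarith)
  · intro t ht
    have h1 := (h.convergesInLaw_norming hρ htail).tendsto
      (y := -t) (continuous_revWeibull hρ).continuousAt
    rw [revWeibull_neg ht] at h1
    refine h1.congr fun n => ?_
    congr 1
    ext ω
    simp only [Set.mem_ofPred_eq]
    rw [← neg_sub (frontier μ x), mul_neg, neg_le_neg_iff]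

/-- An almost surely constant estimator has a distribution function with values `0` and `1` only,
but at `φ - ε` it equals `(1 - V(ε))^n`, strictly between them for small `ε`. -/
lemma variance_pos (h : IsSample P μ X Y x) (hρ : 0 < ρ) (htail : TailCondition μ x ρ) {n : ℕ}
    (hn : 1 ≤ n) : 0 < variance (fdh X Y x n) P := by
  refine lt_of_le_of_ne (variance_nonneg _ _) fun hzero => ?_
  have hae : fdh X Y x n =ᵐ[P] fun _ => ∫ ω, fdh X Y x n ω ∂P := by
    rw [← evariance_eq_zero_iff (h.aemeasurable n), ← ofReal_variance (h.memLp n), ← hzero,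
      ENNReal.ofReal_zero]
  obtain ⟨ε, hε, hε0, hεφ⟩ := (((tendsto_order.1 (h.tendsto_tail hρ htail)).2 1 one_pos).and
    (Ioo_mem_nhdsGT (h.frontier_pos hρ htail))).exists
  have hprob := measureReal_fdh_le (n := n) h.pos h.law h.indep
    (show 0 ≤ frontier μ x - ε by linarith)
  rw [← tail] at hprob
  have hpos := tail_pos h.nonneg h.pos ε hε0
  have hgt : 0 < (1 - tail μ x ε) ^ n := pow_pos (by linarith) n
  have hlt : (1 - tail μ x ε) ^ n < 1 := pow_lt_one₀ (by linarith) (by linarith) (by omega)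
  have hconst : P.real {ω | fdh X Y x n ω ≤ frontier μ x - ε} =
      P.real {_ω : Ω | ∫ ω, fdh X Y x n ω ∂P ≤ frontier μ x - ε} := by
    refine measureReal_congr ?_
    filter_upwards [hae] with ω hω
    exact congrArg (fun z : ℝ => z ≤ frontier μ x - ε) hω
  by_cases hle : ∫ ω, fdh X Y x n ω ∂P ≤ frontier μ x - ε
  · simp only [hle, Set.ofPred_true, probReal_univ] at hconst
    linarith
  · simp only [hle, Set.ofPred_false, measureReal_empty] at hconst
    linarith

/-- The limit law of the standardized estimator. -/
lemma tendsto_standardized (h : IsSample P μ X Y x) (hρ : 0 < ρ) (htail : TailCondition μ x ρ)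
    (y : ℝ) :
    Tendsto (fun n : ℕ => P.real {ω | (fdh X Y x n ω - ∫ ω', fdh X Y x n ω' ∂P) /
        Real.sqrt (variance (fdh X Y x n) P) ≤ y}) atTop
      (𝓝 (revWeibull ρ (Real.sqrt (Real.Gamma (1 + 2 / ρ) - Real.Gamma (1 + 1 / ρ) ^ 2) * y
        - Real.Gamma (1 + 1 / ρ)))) := by
  set T : ℕ → Ω → ℝ := fun n ω => (norming μ x n)⁻¹ * (frontier μ x - fdh X Y x n ω) with hT
  have hT1 : ∀ n, Integrable (T n) P := fun n => by
    simpa using h.integrable_pow n (norming μ x n)⁻¹ 1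
  have hT2 : ∀ n, MemLp (T n) 2 P := fun n =>
    (memLp_two_iff_integrable_sq (hT1 n).aestronglyMeasurable).2 (h.integrable_pow n _ 2)
  have hmean : Tendsto (fun n => ∫ ω, T n ω ∂P) atTop (𝓝 (Real.Gamma (1 + 1 / ρ))) := by
    simpa using h.tendsto_moment hρ htail le_rfl
  have hsq : Tendsto (fun n => ∫ ω, T n ω ^ 2 ∂P) atTop (𝓝 (Real.Gamma (1 + 2 / ρ))) := by
    simpa using h.tendsto_moment hρ htail one_le_two
  have hvar : Tendsto (fun n => Real.sqrt (variance (T n) P)) atTop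
      (𝓝 (Real.sqrt (Real.Gamma (1 + 2 / ρ) - Real.Gamma (1 + 1 / ρ) ^ 2))) := by
    refine ((hsq.sub (hmean.pow 2)).congr fun n => ?_).sqrt
    rw [variance_eq_sub (hT2 n)]
    rfl
  -- In terms of the normalized error `T n`, the standardized event is `-T n ≤ sd(T n) * y - E(T
  -- n)`, whose threshold converges by the first two moments.
  have hlim := (h.convergesInLaw_norming hρ htail).tendsto_of_tendsto (continuous_revWeibull hρ)
    ((hvar.mul_const y).sub hmean)
  refine hlim.congr' ?_
  filter_upwards [eventually_ge_atTop 1] with n hn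
  have hb := h.norming_pos hρ htail n hn
  have hfdh : fdh X Y x n = fun ω => frontier μ x - norming μ x n * T n ω := by
    funext ω
    rw [hT]
    simp only
    rw [mul_inv_cancel_left₀ hb.ne', sub_sub_cancel]
  have hE : ∫ ω, fdh X Y x n ω ∂P = frontier μ x - norming μ x n * ∫ ω, T n ω ∂P := by
    rw [hfdh, integral_sub (integrable_const _) ((hT1 n).const_mul _), integral_const_mul]
    simp
  have hV : variance (fdh X Y x n) P = norming μ x n ^ 2 * variance (T n) P := by
    rw [hfdh, variance_const_sub ((hT1 n).const_mul _).aestronglyMeasurable, variance_const_mul]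
  have hs : Real.sqrt (variance (fdh X Y x n) P) =
      norming μ x n * Real.sqrt (variance (T n) P) := by
    rw [hV, Real.sqrt_mul (sq_nonneg _), Real.sqrt_sq hb.le]
  have hspos := Real.sqrt_pos.2 (h.variance_pos hρ htail hn)
  congr 1
  ext ω
  simp only [Set.mem_ofPred_eq]
  rw [div_le_iff₀ hspos, inv_mul_le_iff₀ hb, hE, hs]
  constructor <;> intro h <;> linarith

end Norming

end IsSample

end FDH

theorem mainTheorem1 {p : ℕ} {Ω : Type*} [MeasurableSpace Ω] (P : Measure Ω)
    [IsProbabilityMeasure P] (μ : Measure ((Fin p → ℝ) × ℝ)) [IsProbabilityMeasure μ]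
    (hμ : ∀ᵐ q ∂μ, 0 ≤ q.1 ∧ 0 ≤ q.2)
    (X : ℕ → Ω → Fin p → ℝ) (Y : ℕ → Ω → ℝ)
    (hlaw : ∀ i, HasLaw (fun ω => (X i ω, Y i ω)) μ P)
    (hindep : iIndepFun (fun i ω => (X i ω, Y i ω)) P)
    (x : Fin p → ℝ) (hx : 0 ≤ x) (hFX : 0 < FDH.marginalCDF μ x)
    (hfin : BddAbove {y : ℝ | 0 ≤ y ∧ FDH.condDF μ x y < 1}) :
    -- (i)
    (∀ (b : ℕ → ℝ) (G : ℝ → ℝ), (∀ n, 1 ≤ n → 0 < b n) → FDH.Nondegenerate G →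
      FDH.ConvergesInLaw P (fun n ω => (b n)⁻¹ * (FDH.fdh X Y x n ω - FDH.frontier μ x)) G →
      ∃ ρ : ℝ, 0 < ρ ∧ ∃ c : ℝ, 0 < c ∧ (∀ y, G y = FDH.revWeibull ρ (y / c)) ∧
        FDH.ConvergesInLaw P
          (fun n ω => (c * b n)⁻¹ * (FDH.fdh X Y x n ω - FDH.frontier μ x)) (FDH.revWeibull ρ)) ∧
    -- (ii), existence of a non-degenerate limit
    ((∃ (b : ℕ → ℝ) (G : ℝ → ℝ), (∀ n, 1 ≤ n → 0 < b n) ∧ FDH.Nondegenerate G ∧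
        FDH.ConvergesInLaw P (fun n ω => (b n)⁻¹ * (FDH.fdh X Y x n ω - FDH.frontier μ x)) G) ↔
      ∃ ρ : ℝ, 0 < ρ ∧ FDH.TailCondition μ x ρ) ∧
    -- (ii), with the same exponent on both sides
    (∀ ρ : ℝ, 0 < ρ →
      ((∃ b : ℕ → ℝ, (∀ n, 1 ≤ n → 0 < b n) ∧
        FDH.ConvergesInLaw P (fun n ω => (b n)⁻¹ * (FDH.fdh X Y x n ω - FDH.frontier μ x))
          (FDH.revWeibull ρ)) ↔
        FDH.TailCondition μ x ρ)) ∧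
    (∀ ρ : ℝ, 0 < ρ → FDH.TailCondition μ x ρ →
      -- (ii), the norming constants
      ((∀ n, 1 ≤ n → 0 < FDH.norming μ x n) ∧
        FDH.ConvergesInLaw P
          (fun n ω => (FDH.norming μ x n)⁻¹ * (FDH.fdh X Y x n ω - FDH.frontier μ x))
          (FDH.revWeibull ρ)) ∧
      -- (iii), moments
      (∀ k : ℕ, 1 ≤ k →
        (∀ n, Integrable
          (fun ω => ((FDH.norming μ x n)⁻¹ * (FDH.frontier μ x - FDH.fdh X Y x n ω)) ^ k) P) ∧
        Tendsto (fun n : ℕ =>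
            ∫ ω, ((FDH.norming μ x n)⁻¹ * (FDH.frontier μ x - FDH.fdh X Y x n ω)) ^ k ∂P)
          atTop (𝓝 (Real.Gamma (1 + k / ρ)))) ∧
      -- (iii), the standardized estimator
      (∀ n, 1 ≤ n → 0 < variance (FDH.fdh X Y x n) P) ∧
      ∀ y : ℝ, Tendsto (fun n : ℕ =>
          P.real {ω | (FDH.fdh X Y x n ω - ∫ ω', FDH.fdh X Y x n ω' ∂P) /
            Real.sqrt (variance (FDH.fdh X Y x n) P) ≤ y})
        atTop (𝓝 (FDH.revWeibull ρ
          (Real.sqrt (Real.Gamma (1 + 2 / ρ) - Real.Gamma (1 + 1 / ρ) ^ 2) * y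
            - Real.Gamma (1 + 1 / ρ))))) := by
  have h : FDH.IsSample P μ X Y x := ⟨hμ, hlaw, hindep, hFX, hfin⟩
  refine ⟨fun b G hb hG hconv => h.exists_eq_revWeibull hb hG hconv, ⟨?_, ?_⟩,
    fun ρ hρ => ⟨?_, ?_⟩, fun ρ hρ htail => ⟨⟨h.norming_pos hρ htail,
      h.convergesInLaw_norming hρ htail⟩, fun k hk => ⟨fun n => h.integrable_pow n _ k,
      h.tendsto_moment hρ htail hk⟩, fun n hn => h.variance_pos hρ htail hn,
      h.tendsto_standardized hρ htail⟩⟩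
  · rintro ⟨b, G, hb, hG, hconv⟩
    obtain ⟨ρ, hρ, c, hc, -, hconv'⟩ := h.exists_eq_revWeibull hb hG hconv
    exact ⟨ρ, hρ, h.tailCondition_of_convergesInLaw (fun n hn => mul_pos hc (hb n hn)) hρ hconv'⟩
  · rintro ⟨ρ, hρ, htail⟩
    exact ⟨_, _, h.norming_pos hρ htail, FDH.nondegenerate_revWeibull,
      h.convergesInLaw_norming hρ htail⟩
  · rintro ⟨b, hb, hconv⟩
    exact h.tailCondition_of_convergesInLaw hb hρ hconv
  · exact fun htail => ⟨_, h.norming_pos hρ htail, h.convergesInLaw_norming hρ htail⟩
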